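/- **Setting.** Let $\mathcal G=(\mathcal V,\mathcal L)$ be a finite directed graph whose links are ordered pairs of distinct nodes, where link $\ell\in\mathcal L$ can transmit at most $C_\ell\in\{0,1,2,\dots\}$ packets per time slot. Let $\overline{\mathcal L}=\mathcal L\cup\{(v,v):v\in\mathcal V\}$; using the self-loop $(v,v)$ means waiting at $v$ and is not capacity-constrained. Write $\mathcal O(v)$ and $\mathcal I(v)$ for the links of $\overline{\mathcal L}$ out of and into $v$. There are finitely many packet types $j$, each with a source $s_j$, a destination $z_j$, a deadline $d_j\in\{0,1,2,\dots\}$ and a weight $w_j\ge 0$; let $d_{\max}=\max_j d_j$. In each slot $t\in\{1,\dots,T\}$, $a_j^t$ packets of type $j$ arrive, where the $a_j^t$ are independent over $j$ and $t$ and $a_j^t\sim\mathrm{Binomial}(N_j,p_j)$ (Bernoulli if $N_j=1$), with known rate $\lambda_j=\mathbb E[a_j^t]=N_jp_j$. A packet arriving at the beginning of slot $t$ yields its weight if it reaches its destination by the end of slot $t+d_j$. A *route-schedule* of type $j$ is a directed walk $k=(k_0,\dots,k_{d_j})$ of links of $\overline{\mathcal L}$ with $k_0\in\mathcal O(s_j)$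 and $k_{d_j}\in\mathcal I(z_j)$, where $k_\tau$ is the link used $\tau$ slots after arrival; $\mathcal K_j$ is the set of all of them, and $k_\tau=\varnothing$ for $\tau>d_j$. Let $L$ be the maximum, over all $j$ and $k\in\mathcal K_j$, of the number of indices $\tau$ with $k_\tau\in\mathcal L$, and let $C_{\min}=\min_{\ell\in\mathcal L}C_\ell$. **Benchmark.** $\mathrm{RI}(T)$ is the random integer program, given the arrivals, $$\max\ \sum_{t=1}^{T}\sum_j w_j\sum_{n=1}^{a_j^t}\sum_{k\in\mathcal K_j}y_{jk}^{nt}$$ over $y_{jk}^{nt}\in\{0,1\}$ subject to $\sum_{k\in\mathcal K_j}y_{jk}^{nt}\le 1$ for all $j$, $t\in\{1,\dots,T\}$, $n\le a_j^t$, and $\sum_{\tau=\max(1,t-d_{\max})}^{\min(t,T)}\sum_j\sum_{n=1}^{a_j^\tau}\sum_{k\in\mathcal K_j:\,k_{t-\tau}=\ell}y_{jk}^{n\tau}\le C_\ell$ for all $\ell\in\mathcal L$, $1\le t\le T+d_{\max}$. Let $W^\star_{\mathrm{RI}(T)}$ be its optimal value. **Algorithm (FBPF).** Compute once an optimal solution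 $f^\star$ of the linear program $F_S$: $$\max\ \sum_j w_j\lambda_j\sum_{\ell\in\mathcal O(s_j)}f_{j\ell}^0$$ subject to $\sum_{\ell\in\mathcal O(s_j)}f_{j\ell}^0\le 1$ for all $j$; $\sum_{\ell\in\mathcal I(v)}f_{j\ell}^{\tau-1}=\sum_{\ell\in\mathcal O(v)}f_{j\ell}^{\tau}$ for all $j$, all $v$ and $1\le\tau\le d_j$; $f_{j\ell}^0=0$ for $\ell\notin\mathcal O(s_j)$ and $f_{j\ell}^{d_j}=0$ for $\ell\notin\mathcal I(z_j)$; $\sum_j\sum_{\tau=0}^{d_j}\lambda_jf_{j\ell}^\tau\le C_\ell/(1+\epsilon)$ for all $\ell\in\mathcal L$; and $f_{j\ell}^\tau\ge 0$ for $\ell\in\overline{\mathcal L}$, $0\le\tau\le d_{\max}$. Then, in each slot, process the unexpired packets present in the network one after another, in an arbitrary order. A type-$j$ packet of age $0$ (at $s_j$) selects link $\ell\in\mathcal O(s_j)$ with probability $f_{j\ell}^{0\star}$ and is dropped with the remaining probability; a packet of age $\tau\in\{1,\dots,d_j\}$ at node $v$ selects $\ell\in\mathcal O(v)$ with probability $f_{j\ell}^{\tau\star}/\sum_{\ell'\in\mathcal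 O(v)}f_{j\ell'}^{\tau\star}$. All selections are independent of each other and of the arrivals. The packet is forwarded over the selected link if that link still has available capacity in this slot, and is dropped otherwise. Let $W_{\mathrm{FBPF}}$ be the total weight of the packets that arrive in slots $1,\dots,T$ and are at their destination at the end of the slot in which their deadline falls. **Theorem.** Let $\epsilon\in(0,1/3)$. The program $F_S$ has an optimal solution, and for every optimal solution and every processing order (which may itself be random), if $$C_{\min}\ \ge\ 2\Big(\frac{1+\epsilon}{\epsilon}\Big)^2\log\frac{L}{\epsilon}\qquad\text{and}\qquad T\ \ge\ \frac{2d_{\max}^2}{\epsilon},$$ then $W_{\mathrm{FBPF}}$ and $W^\star_{\mathrm{RI}(T)}$ are integrable and $$\mathbb E\big[W_{\mathrm{FBPF}}\big]\ \ge\ (1-3\epsilon)\,\mathbb E\big[W^\star_{\mathrm{RI}(T)}\big].$$ The same holds if the forwarding is stopped at the end of any slot $H\ge T$ and $W_{\mathrm{FBPF}}$ counts the packets that are at their destination when their deadline falls or at the end of slot $H$, whichever comes first. (If $L=0$ or $\mathcal L=\varnothing$, the capacity condition is void.) -/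

import Mathlib

open MeasureTheory ProbabilityTheory

/-- A slotted-time communication network with node set `V`, together with packet types `J`.
The links are ordered pairs of distinct nodes, `cap ℓ` is the number of packets that link `ℓ` can
transmit in a slot, and a packet type has a source, a destination, an end-to-end deadline and a
weight. -/
structure PacketNetwork (V J : Type*) where
  links : Finset (V × V)
  loopless : ∀ v, (v, v) ∉ links
  cap : V × V → ℕ
  src : J → V
  dst : J → V
  deadline : J → ℕ
  weight : J → ℝ
  weight_nonneg : ∀ j, 0 ≤ weight j

/-- A packet `⟨(j, t), n⟩`: the `n`-th packet (counted from `0`) of type `j` that arrives at the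
beginning of slot `t`. -/
abbrev Packet (J : Type*) := Σ _ : J × ℕ, ℕ

namespace Packet

variable {J : Type*}

abbrev type (q : Packet J) : J := q.1.1

abbrev arrival (q : Packet J) : ℕ := q.1.2

abbrev index (q : Packet J) : ℕ := q.2

end Packet

namespace PacketNetwork

variable {V J : Type*} [Fintype V] [DecidableEq V] [Fintype J] (net : PacketNetwork V J)

/-- The links together with a self-loop at every node. Scheduling a packet over a self-loop means
that it stays where it is; self-loops have no capacity constraint. -/
def extLinks : Finset (V × V) :=
  net.links ∪ Finset.univ.image (fun v : V => (v, v))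

/-- Outgoing links of `v`, self-loop included. -/
def outLinks (v : V) : Finset (V × V) := net.extLinks.filter (fun l => l.1 = v)

/-- Incoming links of `v`, self-loop included. -/
def inLinks (v : V) : Finset (V × V) := net.extLinks.filter (fun l => l.2 = v)

/-- The maximum deadline of a packet type. -/
def dmax : ℕ := Finset.univ.sup net.deadline

/-- Relative route-schedules of a type-`j` packet: directed walks `k 0, …, k (deadline j)` in the
graph with self-loops, from the source to the destination; `k τ` is the link that the packet uses
in the `τ`-th slot after its arrival. -/
def IsRouteSchedule (j : J) (k : Fin (net.deadline j + 1) → V × V) : Prop :=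
  (∀ τ, k τ ∈ net.extLinks) ∧
  (∀ τ : Fin (net.deadline j), (k τ.castSucc).2 = (k τ.succ).1) ∧
  k 0 ∈ net.outLinks (net.src j) ∧
  k (Fin.last (net.deadline j)) ∈ net.inLinks (net.dst j)

open Classical in
/-- The finite set of all route-schedules of type `j`. -/
noncomputable def routes (j : J) : Finset (Fin (net.deadline j + 1) → V × V) :=
  Finset.univ.filter (fun k => net.IsRouteSchedule j k)

/-- `k` uses the link `l` at relative slot `τ` (false when `τ` exceeds the deadline). -/
def UsesAt {d : ℕ} (k : Fin (d + 1) → V × V) (τ : ℕ) (l : V × V) : Prop :=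
  ∃ h : τ < d + 1, k ⟨τ, h⟩ = l

/-- The maximum length of a packet's route: the largest number of slots in which a route-schedule
uses a link of the network (waiting at a node does not count). -/
noncomputable def maxRouteLength : ℕ :=
  Finset.univ.sup fun j =>
    (net.routes j).sup fun k => (Finset.univ.filter (fun τ => k τ ∈ net.links)).card

/-! ### The random integer program -/

/-- Decision variables of the integer program: `y j t n k` says whether the `n`-th packet of type
`j` arriving at slot `t` is scheduled over the route-schedule `k`. -/
abbrev Schedule : Type _ :=
  (j : J) → ℕ → ℕ → (Fin (net.deadline j + 1) → V × V) → ℕ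

open Classical in
/-- The constraints of the integer program over horizon `T`, for the arrival numbers `a j t`. -/
structure RIFeasible (T : ℕ) (a : J → ℕ → ℕ) (y : net.Schedule) : Prop where
  binary : ∀ j t n k, y j t n k = 0 ∨ y j t n k = 1
  one_choice : ∀ t ∈ Finset.Icc 1 T, ∀ j, ∀ n < a j t, ∑ k ∈ net.routes j, y j t n k ≤ 1
  capacity : ∀ l ∈ net.links, ∀ t ∈ Finset.Icc 1 (T + net.dmax),
    ∑ τ ∈ Finset.Icc (max 1 (t - net.dmax)) (min t T), ∑ j, ∑ n ∈ Finset.range (a j τ),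
      ∑ k ∈ (net.routes j).filter (fun k => UsesAt k (t - τ) l), y j τ n k ≤ net.cap l

/-- The objective of the integer program: total weight of the scheduled packets. -/
noncomputable def riObjective (T : ℕ) (a : J → ℕ → ℕ) (y : net.Schedule) : ℝ :=
  ∑ t ∈ Finset.Icc 1 T, ∑ j, net.weight j *
    ∑ n ∈ Finset.range (a j t), ∑ k ∈ net.routes j, (y j t n k : ℝ)

/-- The optimal value of the integer program (a maximum, see `isGreatest_riOptimum`). -/
noncomputable def riOptimum (T : ℕ) (a : J → ℕ → ℕ) : ℝ :=
  sSup (net.riObjective T a '' {y | net.RIFeasible T a y})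

theorem isGreatest_riOptimum (T : ℕ) (a : J → ℕ → ℕ) :
    IsGreatest (net.riObjective T a '' {y | net.RIFeasible T a y}) (net.riOptimum T a) := by
  classical
  set S := net.riObjective T a '' {y | net.RIFeasible T a y} with hS
  have hne : S.Nonempty := by
    refine ⟨_, fun _ _ _ _ => 0, ⟨?_, ?_, ?_⟩, rfl⟩ <;> simp
  have hfin : S.Finite := by
    let B : J → ℕ := fun j => ∑ t ∈ Finset.Icc 1 T, a j t
    let F : Finset (J → ℕ) := Fintype.piFinset fun j => Finset.range (B j + 1)
    refine (F.finite_toSet.image fun m : J → ℕ => ∑ j, net.weight j * (m j : ℝ)).subset ?_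
    rintro _ ⟨y, hy, rfl⟩
    refine ⟨fun j => ∑ t ∈ Finset.Icc 1 T, ∑ n ∈ Finset.range (a j t),
      ∑ k ∈ net.routes j, y j t n k, ?_, ?_⟩
    · simp only [F, Finset.mem_coe, Fintype.mem_piFinset, Finset.mem_range, Nat.lt_succ_iff, B]
      intro j
      refine Finset.sum_le_sum fun t ht => ?_
      calc _ ≤ ∑ n ∈ Finset.range (a j t), 1 :=
            Finset.sum_le_sum fun n hn => hy.one_choice t ht j n (Finset.mem_range.1 hn)
        _ = a j t := by simp
    · simp only [riObjective]
      rw [Finset.sum_comm]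
      refine Finset.sum_congr rfl fun j _ => ?_
      push_cast
      rw [Finset.mul_sum]
  exact ⟨hne.csSup_mem hfin, fun x hx => le_csSup hfin.bddAbove hx⟩

/-! ### The flow linear program -/

/-- The constraints of the flow linear program, for arrival rates `rate j`, with capacities reduced
by the factor `1 + ε`. The variable `f j l τ` is the fraction of type-`j` packets forwarded over
`l` at age `τ`. -/
structure FlowFeasible (rate : J → ℝ) (ε : ℝ) (f : J → V × V → ℕ → ℝ) : Prop where
  nonneg : ∀ j, ∀ l ∈ net.extLinks, ∀ τ ≤ net.dmax, 0 ≤ f j l τ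
  one_choice : ∀ j, ∑ l ∈ net.outLinks (net.src j), f j l 0 ≤ 1
  conservation : ∀ j v, ∀ τ ∈ Finset.Icc 1 (net.deadline j),
    ∑ l ∈ net.inLinks v, f j l (τ - 1) = ∑ l ∈ net.outLinks v, f j l τ
  source : ∀ j, ∀ l ∈ net.extLinks, l ∉ net.outLinks (net.src j) → f j l 0 = 0
  destination : ∀ j, ∀ l ∈ net.extLinks, l ∉ net.inLinks (net.dst j) →
    f j l (net.deadline j) = 0
  capacity : ∀ l ∈ net.links,
    ∑ j, ∑ τ ∈ Finset.range (net.deadline j + 1), rate j * f j l τ ≤ net.cap l / (1 + ε)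

/-- The objective of the flow linear program. -/
noncomputable def flowObjective (rate : J → ℝ) (f : J → V × V → ℕ → ℝ) : ℝ :=
  ∑ j, net.weight j * rate j * ∑ l ∈ net.outLinks (net.src j), f j l 0

/-- `f` is an optimal solution of the flow linear program. -/
def IsOptimalFlow (rate : J → ℝ) (ε : ℝ) (f : J → V × V → ℕ → ℝ) : Prop :=
  net.FlowFeasible rate ε f ∧
    ∀ g, net.FlowFeasible rate ε g → net.flowObjective rate g ≤ net.flowObjective rate f

/-! ### Flow-based probabilistic forwarding -/

/-- The probability with which a type-`j` packet of age `τ` that is at node `v` selects the link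
from `v` to `u`. With the remaining probability no link is selected. (A packet of positive age is
at `v` with positive probability only if the denominator is positive.) -/
noncomputable def forwardProb (f : J → V × V → ℕ → ℝ) (j : J) (τ : ℕ) (v u : V) : ℝ :=
  if (v, u) ∈ net.extLinks then
    if τ = 0 then f j (v, u) 0 else f j (v, u) τ / ∑ l ∈ net.outLinks v, f j l τ
  else 0

/-- The packets that arrive during slots `1, …, T`. -/
def packets (T : ℕ) (a : J → ℕ → ℕ) : Finset (Packet J) :=
  (Finset.univ ×ˢ Finset.Icc 1 T).sigma fun jt => Finset.range (a jt.1 jt.2)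

section Dynamics

variable (T : ℕ) (a : J → ℕ → ℕ) (sel : Packet J → ℕ → V → Option V)
  (prio : ℕ → Packet J → ℕ)

open Classical in
/-- The node at which the packet `q` is found during slot `s`, given the nodes `prev` where the
packets were at the end of slot `s - 1`; `none` if `q` is not in the network (not arrived yet,
dropped, or expired). -/
noncomputable def nodeIn (prev : Packet J → Option V) (s : ℕ) (q : Packet J) : Option V :=
  if q ∈ packets T a then
    if s = q.arrival then some (net.src q.type)
    else if q.arrival < s ∧ s ≤ q.arrival + net.deadline q.type then prev q
    else none
  else none

/-- The link that `q` selects in slot `s`; `sel q τ v` is the random choice made for `q` when its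
age is `τ` and it is at `v`: the next node, or `none` if `q` is dropped at will. -/
noncomputable def request (prev : Packet J → Option V) (s : ℕ) (q : Packet J) :
    Option (V × V) :=
  (net.nodeIn T a prev s q).bind fun v => (sel q (s - q.arrival) v).map fun u => (v, u)

open Classical in
/-- The node where `q` is at the end of slot `s`. In each slot the packets are processed in
increasing order of `prio s`. A packet that selects a self-loop stays at its node. A packet
that selects a link `l` of the network is forwarded if fewer than `cap l` of the packets that
selected `l` were processed before it, that is, if `l` still has available capacity; otherwise
it is dropped. -/
noncomputable def slotStep (prev : Packet J → Option V) (s : ℕ) (q : Packet J) : Option V :=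
  (net.request T a sel prev s q).bind fun l =>
    if l ∈ net.links →
        ((packets T a).filter fun r =>
          net.request T a sel prev s r = some l ∧ prio s r < prio s q).card < net.cap l
    then some l.2 else none

/-- The node where each packet is at the end of slot `s` (`none` if it is not in the network). -/
noncomputable def endNode : ℕ → Packet J → Option V
  | 0 => fun _ => none
  | s + 1 => net.slotStep T a sel prio (endNode s) (s + 1)

open Classical in
/-- The total weight of the packets delivered on time when the forwarding is run during slots
`1, …, H`: a packet counts if it is at its destination at the end of the slot in which its
deadline falls (or at the end of the run, if that comes earlier). -/
noncomputable def reward (H : ℕ) : ℝ :=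
  ∑ q ∈ packets T a,
    if net.endNode T a sel prio (min (q.arrival + net.deadline q.type) H) q
        = some (net.dst q.type)
    then net.weight q.type else 0

end Dynamics

/-- The random inputs of flow-based probabilistic forwarding with forwarding variables `f`:
arrivals `a j t`, link selections `sel q τ v`, and processing orders `prio s`. For each type, the
arrivals in slots `1, …, T` are i.i.d. binomial with parameters `N j` and `p j` (Bernoulli if
`N j = 1`); the selections follow the forwarding probabilities; all arrivals and all selections
are mutually independent. The order in which packets are processed within a slot is
arbitrary, and may itself be random and depend on everything else. -/
structure IsForwardingModel {Ω : Type*} [MeasurableSpace Ω] (μ : Measure Ω) (T : ℕ)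
    (N : J → ℕ) (p : J → unitInterval) (f : J → V × V → ℕ → ℝ)
    (a : J → ℕ → Ω → ℕ) (sel : Packet J → ℕ → V → Ω → Option V)
    (prio : ℕ → Packet J → Ω → ℕ) : Prop where
  measurable_arrivals : ∀ j t, Measurable (a j t)
  measurable_sel : ∀ q τ v, Measurable[_, ⊤] (sel q τ v)
  measurable_prio : ∀ s q, Measurable (prio s q)
  arrivals_law : ∀ j, ∀ t ∈ Finset.Icc 1 T, HasLaw (a j t) (binomial (N j) (p j)) μ
  sel_law : ∀ q : Packet J, q.arrival ∈ Finset.Icc 1 T → q.index < N q.type →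
    ∀ τ ≤ net.deadline q.type, ∀ v u,
      μ.real {ω | sel q τ v ω = some u} = net.forwardProb f q.type τ v u
  indep : iIndep (Sum.elim
    (fun jt : J × ℕ => MeasurableSpace.comap (a jt.1 jt.2) ⊤)
    (fun x : Packet J × ℕ × V => MeasurableSpace.comap (sel x.1 x.2.1 x.2.2) ⊤)) μ
  prio_injective : ∀ s ω, Function.Injective fun q => prio s q ω

end PacketNetwork

/-! Both sides are compared with the optimum `O` of the flow program.

Lower bound. Couple the forwarding with a free motion in which every packet follows the same
selections but links have unlimited capacity. By flow conservation a free packet uses link `l` at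
age `τ` with probability exactly `f j l τ` (`measureReal_freeLink_eq_flow`), and distinct packets
move independently. A packet can be dropped by a full link only if at least `cap l` other packets
load that link in the free motion in the same slot. This condition ignores the processing order and
what congestion did to the other packets (`endNode_eq_freeNode`).

The expected load of a link is at most `cap l / (1 + ε)`. Markov's inequality for the product of the
factors `1 + ε` over the loading packets gives an overload probability of at most `exp (-(cap l * (ε
/ (1 + ε)) ^ 2 / 2))`, which the capacity condition makes at most `ε / L`. The batch sizes are
random, so there is no fixed packet to condition on. Instead one sums over a marked packet of the
batch, and the derivative of the binomial generating function evaluates this sum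
(`integral_prod_batch`, `exists_overload_bound`). An admitted packet follows a route-schedule almost
surely, hence crosses at most `L` network links, and the union bound costs a fraction `ε` of the
admitted flow. Counting only arrivals up to slot `T - dmax` gives an expected reward of at least `(T
- dmax) * (1 - ε) * O` (`le_integral_reward`).

Upper bound. Fix an optimal integer solution for each arrival vector and average the numbers of
packets on each route. The averages respect the arrival rates over `T` slots and the total link
capacities over `T + dmax` slots. Divided by `(T + dmax) * (1 + ε)`, they form a feasible flow, so
the benchmark is at most `(T + dmax) * (1 + ε) * O` (`integral_riOptimum_le`).

The condition on `T` makes the boundary terms in `dmax` small enough for the factor `1 - 3 * ε`. -/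

set_option linter.unusedSectionVars false

/-! ### Independent blocks and binomial mixtures -/

theorem integral_finset_prod_of_iIndep {Ω ι κ : Type*} {mΩ : MeasurableSpace Ω} {μ : Measure Ω}
    [IsProbabilityMeasure μ] {M : ι → MeasurableSpace Ω} (hle : ∀ i, M i ≤ mΩ) (h : iIndep M μ)
    {S : κ → Set ι} (hS : Pairwise (Function.onFun Disjoint S)) {X : κ → Ω → ℝ}
    (hX : ∀ k, Measurable[⨆ i ∈ S k, M i] (X k)) (hint : ∀ k, Integrable (X k) μ)
    (s : Finset κ) :
    Integrable (fun ω => ∏ k ∈ s, X k ω) μ ∧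
      ∫ ω, ∏ k ∈ s, X k ω ∂μ = ∏ k ∈ s, ∫ ω, X k ω ∂μ := by
  classical
  induction s using Finset.induction_on with
  | empty => simp
  | insert k s hk ih =>
    have hprod : Measurable[⨆ i ∈ (⋃ k ∈ s, S k), M i] fun ω => ∏ k ∈ s, X k ω := by
      refine Finset.measurable_fun_prod s fun k' hk' => (hX k').mono ?_ le_rfl
      exact biSup_mono fun i hi => Set.mem_biUnion hk' hi
    have hdisj : Disjoint (S k) (⋃ k ∈ s, S k) := by
      simp only [Set.disjoint_iUnion_right]
      intro k' hk'
      exact hS fun e => hk (e ▸ hk')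
    -- The blocks are disjoint, so the new factor and the product of the earlier ones depend on
    -- disjoint sets of inputs.
    have hind : IndepFun (X k) (fun ω => ∏ k ∈ s, X k ω) μ :=
      indep_of_indep_of_le (indep_iSup_of_disjoint hle h hdisj)
        (hX k).comap_le hprod.comap_le
    have hsup : ∀ S : Set ι, (⨆ i ∈ S, M i) ≤ mΩ := fun S => iSup₂_le fun i _ => hle i
    simp_rw [Finset.prod_insert hk]
    rw [← ih.2]
    refine ⟨hind.integrable_mul (hint k) ih.1, ?_⟩
    exact hind.integral_fun_mul_eq_mul_integral
      ((hX k).mono (hsup _) le_rfl).aestronglyMeasurable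
      (hprod.mono (hsup _) le_rfl).aestronglyMeasurable

theorem sum_binomial_mul_pow (N : ℕ) (p x : ℝ) :
    ∑ k ∈ Finset.range (N + 1), (N.choose k * p ^ k * (1 - p) ^ (N - k)) * x ^ k
      = (1 + p * (x - 1)) ^ N := by
  rw [show 1 + p * (x - 1) = p * x + (1 - p) by ring, add_pow]
  refine Finset.sum_congr rfl fun k _ => ?_
  rw [mul_pow]; ring

/-- The derivative in `x` of the generating function identity. The factor `k` will count the choices
of a marked packet and `x ^ (k - 1)` will carry the contributions of the others. -/
theorem sum_binomial_mul_natCast_mul_pow (N : ℕ) (p x : ℝ) :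
    ∑ k ∈ Finset.range (N + 1), (N.choose k * p ^ k * (1 - p) ^ (N - k)) * (k * x ^ (k - 1))
      = N * p * (1 + p * (x - 1)) ^ (N - 1) := by
  cases N with
  | zero => simp
  | succ N =>
    rw [Finset.sum_range_succ', Nat.add_sub_cancel, ← sum_binomial_mul_pow, Finset.mul_sum]
    simp only [Nat.cast_zero, zero_mul, mul_zero, add_zero]
    refine Finset.sum_congr rfl fun k _ => ?_
    have := Nat.add_one_mul_choose_eq N k
    have h2 : ((N : ℝ) + 1) * (N.choose k) = ((N + 1).choose (k + 1)) * (k + 1) := by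
      exact_mod_cast this
    rw [Nat.add_sub_add_right, Nat.add_sub_cancel]
    push_cast
    linear_combination (-p ^ (k + 1) * (1 - p) ^ (N - k) * x ^ k) * h2

/-- Mixing a family of random variables over an independent binomial index. -/
theorem integral_comp_binomial {Ω : Type*} {m' mΩ : MeasurableSpace Ω} {μ : Measure Ω}
    [IsProbabilityMeasure μ] {N : ℕ} {p : unitInterval} {a : Ω → ℕ} (ha : Measurable a)
    (hlaw : HasLaw a (binomial N p) μ) (hm' : m' ≤ mΩ)
    (hind : Indep (MeasurableSpace.comap a ⊤) m' μ) {Y : ℕ → Ω → ℝ}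
    (hY : ∀ k, Measurable[m'] (Y k)) (hint : ∀ k, Integrable (Y k) μ) :
    Integrable (fun ω => Y (a ω) ω) μ ∧
      ∫ ω, Y (a ω) ω ∂μ = ∑ k ∈ Finset.range (N + 1),
        (N.choose k * (p : ℝ) ^ k * (1 - p) ^ (N - k)) * ∫ ω, Y k ω ∂μ := by
  have hset : ∀ k, MeasurableSet {ω | a ω = k} := fun k => ha (measurableSet_singleton k)
  have hae : (fun ω => Y (a ω) ω) =ᵐ[μ] fun ω => ∑ k ∈ Finset.range (N + 1),
      {ω | a ω = k}.indicator 1 ω * Y k ω := by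
    filter_upwards [ae_le_of_hasLaw_binomial hlaw] with ω hω
    rw [Finset.sum_eq_single (a ω)]
    · simp
    · intro b _ hb
      simp [Ne.symm hb]
    · intro h
      exact absurd (Finset.mem_range.2 (Nat.lt_succ_of_le hω)) h
  have hterm : ∀ k ∈ Finset.range (N + 1),
      Integrable (fun ω => {ω | a ω = k}.indicator 1 ω * Y k ω) μ := fun k _ =>
    (hint k).bdd_mul (c := 1) (measurable_const.indicator (hset k)).aestronglyMeasurable
      (ae_of_all _ fun ω => by by_cases h : a ω = k <;> simp [h])
  refine ⟨(integrable_finsetSum _ hterm).congr hae.symm, ?_⟩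
  rw [integral_congr_ae hae, integral_finsetSum _ hterm]
  refine Finset.sum_congr rfl fun k _ => ?_
  have hI : Measurable[MeasurableSpace.comap a ⊤] ({ω | a ω = k}.indicator (1 : Ω → ℝ)) :=
    measurable_const.indicator ⟨{k}, trivial, rfl⟩
  have : IndepFun ({ω | a ω = k}.indicator (1 : Ω → ℝ)) (Y k) μ :=
    indep_of_indep_of_le hind hI.comap_le (hY k).comap_le
  rw [this.integral_fun_mul_eq_mul_integral
    (measurable_const.indicator (hset k)).aestronglyMeasurable
    ((hY k).mono hm' le_rfl).aestronglyMeasurable, integral_indicator_one (hset k),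
    ← binomial_real_singleton]
  congr 1
  rw [← hlaw.map_eq, map_measureReal_apply ha (measurableSet_singleton k)]
  rfl

/-- The Chernoff exponent of the relative capacity slack `ε / (1 + ε)`. -/
theorem exp_div_one_add_pow_le {ε : ℝ} (hε : 0 < ε) (C : ℕ) :
    Real.exp (ε * (C / (1 + ε))) / (1 + ε) ^ C ≤ Real.exp (-(C * (ε / (1 + ε)) ^ 2 / 2)) := by
  have h1 : 0 < 1 + ε := by linarith
  set u := ε / (1 + ε) with hu
  have hu0 : 0 < u := by positivity
  have hu1 : u < 1 := by rw [hu, div_lt_one h1]; linarith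
  -- Since `1 - u = (1 + ε)⁻¹`, the number `log (1 + ε)` is the series `∑ u ^ i / i`; its first two
  -- terms suffice. The linear term cancels the mean, and the quadratic one is the gain.
  have hlog : u + u ^ 2 / 2 ≤ Real.log (1 + ε) := by
    have hs := Real.hasSum_pow_div_log_of_abs_lt_one (x := u) (by rw [abs_of_pos hu0]; exact hu1)
    have := sum_le_hasSum (Finset.range 2) (fun i _ => by positivity) hs
    have e : 1 - u = (1 + ε)⁻¹ := by rw [hu]; field_simp; ring
    rw [e, Real.log_inv, neg_neg] at this
    simp only [Finset.sum_range_succ, Finset.sum_range_zero] at this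
    norm_num at this
    linarith
  have hpow : (1 + ε) ^ C = Real.exp (C * Real.log (1 + ε)) := by
    rw [Real.exp_nat_mul, Real.exp_log h1]
  rw [hpow, ← Real.exp_sub, Real.exp_le_exp]
  have : ε * (C / (1 + ε)) = C * u := by rw [hu]; ring
  rw [this]
  have := mul_le_mul_of_nonneg_left hlog (Nat.cast_nonneg (α := ℝ) C)
  linarith

/-! ### The unconstrained motion of a packet -/

namespace PacketNetwork

variable {V J : Type*} [Fintype V] [DecidableEq V] [Fintype J] {net : PacketNetwork V J}

variable (net) in
/-- The node where the packet `q` would be at age `τ` if links had unlimited capacity. -/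
def freeNode (sel : Packet J → ℕ → V → Option V) (q : Packet J) : ℕ → Option V
  | 0 => some (net.src q.type)
  | τ + 1 => (freeNode sel q τ).bind (sel q τ)

variable (net) in
/-- The link that the packet `q` would select at age `τ` if links had unlimited capacity. -/
def freeLink (sel : Packet J → ℕ → V → Option V) (q : Packet J) (τ : ℕ) : Option (V × V) :=
  (net.freeNode sel q τ).bind fun v => (sel q τ v).map fun u => (v, u)

theorem freeLink_eq_some {sel : Packet J → ℕ → V → Option V} {q : Packet J} {τ : ℕ} {l : V × V} :
    net.freeLink sel q τ = some l ↔ net.freeNode sel q τ = some l.1 ∧ sel q τ l.1 = some l.2 := by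
  obtain ⟨v, u⟩ := l
  simp only [freeLink, Option.bind_eq_some_iff, Option.map_eq_some_iff, Prod.mk.injEq]
  constructor
  · rintro ⟨v', hv, u', hu, rfl, rfl⟩
    exact ⟨hv, hu⟩
  · rintro ⟨hv, hu⟩
    exact ⟨v, hv, u, hu, rfl, rfl⟩

theorem freeNode_succ_eq_some {sel : Packet J → ℕ → V → Option V} {q : Packet J} {τ : ℕ} {u : V} :
    net.freeNode sel q (τ + 1) = some u ↔ ∃ v, net.freeLink sel q τ = some (v, u) := by
  simp [freeNode, Option.bind_eq_some_iff, freeLink_eq_some]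

/-! ### Measurability of the unconstrained motion -/

theorem measurableSet_freeNode {Ω : Type*} {m : MeasurableSpace Ω}
    {sel : Packet J → ℕ → V → Ω → Option V} {q : Packet J} {τ : ℕ}
    (h : ∀ τ' < τ, ∀ v u, MeasurableSet {ω | sel q τ' v ω = some u}) (v : V) :
    MeasurableSet {ω | net.freeNode (fun q τ v => sel q τ v ω) q τ = some v} := by
  induction τ generalizing v with
  | zero => exact MeasurableSet.const (some (net.src q.type) = some v)
  | succ τ ih =>
    have : {ω | net.freeNode (fun q τ v => sel q τ v ω) q (τ + 1) = some v} =
        ⋃ w, {ω | net.freeNode (fun q τ v => sel q τ v ω) q τ = some w} ∩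
          {ω | sel q τ w ω = some v} := by
      ext ω
      simp [freeNode_succ_eq_some, freeLink_eq_some]
    rw [this]
    exact MeasurableSet.iUnion fun w => (ih (fun τ' hτ => h τ' (by omega)) w).inter
      (h τ (by omega) w v)

theorem measurableSet_freeLink {Ω : Type*} {m : MeasurableSpace Ω}
    {sel : Packet J → ℕ → V → Ω → Option V} {q : Packet J} {τ : ℕ}
    (h : ∀ τ' ≤ τ, ∀ v u, MeasurableSet {ω | sel q τ' v ω = some u}) (l : V × V) :
    MeasurableSet {ω | net.freeLink (fun q τ v => sel q τ v ω) q τ = some l} := by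
  simp only [freeLink_eq_some, Set.ofPred_and]
  exact (measurableSet_freeNode (fun τ' hτ => h τ' hτ.le) _).inter (h τ le_rfl _ _)

/-! ### The input σ-algebras -/

/-- The σ-algebras generated by the individual arrival numbers and link selections. -/
@[reducible] def inputAlgebra {Ω : Type*} (a : J → ℕ → Ω → ℕ) (sel : Packet J → ℕ → V → Ω → Option V) :
    (J × ℕ) ⊕ (Packet J × ℕ × V) → MeasurableSpace Ω :=
  Sum.elim (fun jt => MeasurableSpace.comap (a jt.1 jt.2) ⊤)
    (fun x => MeasurableSpace.comap (sel x.1 x.2.1 x.2.2) ⊤)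

/-- The indices of the selections of the packet `q`. -/
def packetInputs (q : Packet J) : Set ((J × ℕ) ⊕ (Packet J × ℕ × V)) :=
  {i | ∃ x, i = Sum.inr (q, x)}

/-- The indices of the arrival number and of the selections of the packets of one type that arrive
in one slot. -/
def batchInputs (g : J × ℕ) : Set ((J × ℕ) ⊕ (Packet J × ℕ × V)) :=
  {i | i = Sum.inl g ∨ ∃ n x, i = Sum.inr (⟨g, n⟩, x)}

theorem packetInputs_subset_batchInputs (g : J × ℕ) (n : ℕ) :
    packetInputs (V := V) ⟨g, n⟩ ⊆ batchInputs g := by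
  rintro _ ⟨x, rfl⟩
  exact Or.inr ⟨n, x, rfl⟩

theorem pairwise_disjoint_packetInputs :
    Pairwise (Function.onFun Disjoint (packetInputs (V := V) (J := J))) := by
  intro q r hqr
  rw [Function.onFun, Set.disjoint_left]
  rintro _ ⟨x, rfl⟩ ⟨y, hy⟩
  simp only [Sum.inr.injEq, Prod.mk.injEq] at hy
  exact hqr hy.1

theorem pairwise_disjoint_batchInputs :
    Pairwise (Function.onFun Disjoint (batchInputs (V := V) (J := J))) := by
  intro g h hgh
  rw [Function.onFun, Set.disjoint_left]
  rintro _ (rfl | ⟨n, x, rfl⟩) (hy | ⟨m, y, hy⟩)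
  · exact hgh (by simpa using hy)
  · simp at hy
  · simp at hy
  · simp only [Sum.inr.injEq, Prod.mk.injEq, Sigma.mk.injEq] at hy
    exact hgh hy.1.1

section

variable {Ω : Type*} {a : J → ℕ → Ω → ℕ} {sel : Packet J → ℕ → V → Ω → Option V}

theorem measurableSet_sel_of_mem {S : Set ((J × ℕ) ⊕ (Packet J × ℕ × V))} {q : Packet J} {τ : ℕ}
    {v : V} (h : Sum.inr (q, τ, v) ∈ S) (o : Option V) :
    MeasurableSet[⨆ i ∈ S, inputAlgebra a sel i] {ω | sel q τ v ω = o} :=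
  le_biSup (inputAlgebra a sel) h _ ⟨{o}, trivial, rfl⟩

theorem measurable_arrival_of_mem {S : Set ((J × ℕ) ⊕ (Packet J × ℕ × V))} {g : J × ℕ}
    (h : Sum.inl g ∈ S) : Measurable[⨆ i ∈ S, inputAlgebra a sel i] (a g.1 g.2) := by
  intro s _
  exact le_biSup (inputAlgebra a sel) h _ ⟨s, trivial, rfl⟩

theorem measurableSet_freeLink_packetInputs (q : Packet J) (τ : ℕ) (l : V × V) :
    MeasurableSet[⨆ i ∈ packetInputs q, inputAlgebra a sel i]
      {ω | net.freeLink (fun q τ v => sel q τ v ω) q τ = some l} :=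
  measurableSet_freeLink (m := ⨆ i ∈ packetInputs q, inputAlgebra a sel i)
    (fun _ _ _ _ => measurableSet_sel_of_mem (show _ ∈ packetInputs q from ⟨_, rfl⟩) _) l

end

/-! ### The law of the unconstrained motion -/

section Law

variable {Ω : Type*} {mΩ : MeasurableSpace Ω} {μ : Measure Ω} {T : ℕ}
  {N : J → ℕ} {p : J → unitInterval} {f : J → V × V → ℕ → ℝ}
  {a : J → ℕ → Ω → ℕ} {sel : Packet J → ℕ → V → Ω → Option V}
  {prio : ℕ → Packet J → Ω → ℕ} {rate : J → ℝ} {ε : ℝ}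

theorem IsForwardingModel.inputAlgebra_le (hM : net.IsForwardingModel μ T N p f a sel prio) (i) :
    inputAlgebra a sel i ≤ mΩ := by
  rcases i with ⟨j, t⟩ | ⟨q, τ, v⟩
  · exact (hM.measurable_arrivals j t).comap_le
  · exact (hM.measurable_sel q τ v).comap_le

theorem IsForwardingModel.biSup_inputAlgebra_le
    (hM : net.IsForwardingModel μ T N p f a sel prio) (S : Set _) :
    (⨆ i ∈ S, inputAlgebra a sel i) ≤ mΩ :=
  iSup₂_le fun i _ => hM.inputAlgebra_le i

theorem IsForwardingModel.measurableSet_sel (hM : net.IsForwardingModel μ T N p f a sel prio)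
    (q : Packet J) (τ : ℕ) (v : V) (o : Option V) : MeasurableSet {ω | sel q τ v ω = o} :=
  hM.measurable_sel q τ v (show MeasurableSet[⊤] {o} from trivial)

variable [IsProbabilityMeasure μ]

/-- The node at age `τ` depends on selections at smaller ages only, and these are independent of the
selection made at age `τ`. -/
theorem IsForwardingModel.measureReal_freeLink
    (hM : net.IsForwardingModel μ T N p f a sel prio) {q : Packet J}
    (hq : q.arrival ∈ Finset.Icc 1 T) (hn : q.index < N q.type) {τ : ℕ}
    (hτ : τ ≤ net.deadline q.type) (l : V × V) :
    μ.real {ω | net.freeLink (fun q τ v => sel q τ v ω) q τ = some l} =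
      μ.real {ω | net.freeNode (fun q τ v => sel q τ v ω) q τ = some l.1} *
        net.forwardProb f q.type τ l.1 l.2 := by
  have hdisj : Disjoint {i | ∃ τ' < τ, ∃ v : V, i = Sum.inr (q, τ', v)}
      {(Sum.inr (q, τ, l.1) : (J × ℕ) ⊕ (Packet J × ℕ × V))} := by
    rw [Set.disjoint_singleton_right]
    rintro ⟨τ', hτ', v, h⟩
    simp only [Sum.inr.injEq, Prod.mk.injEq, true_and] at h
    omega
  have hind := indep_iSup_of_disjoint (m := inputAlgebra a sel) hM.inputAlgebra_le hM.indep hdisj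
  rw [Indep_iff] at hind
  simp only [freeLink_eq_some, Set.ofPred_and, measureReal_def]
  rw [hind _ _ (measurableSet_freeNode (m := ⨆ i ∈ {i | ∃ τ' < τ, ∃ v : V, i = Sum.inr (q, τ', v)},
    inputAlgebra a sel i) (fun τ' hτ' v u => measurableSet_sel_of_mem (by exact ⟨τ', hτ', v, rfl⟩) _) _)
    (measurableSet_sel_of_mem (Set.mem_singleton _) _), ENNReal.toReal_mul,
    ← hM.sel_law q hq hn τ hτ l.1 l.2]
  rfl

theorem IsForwardingModel.measureReal_freeNode_succ
    (hM : net.IsForwardingModel μ T N p f a sel prio) (q : Packet J) (τ : ℕ) (u : V) :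
    μ.real {ω | net.freeNode (fun q τ v => sel q τ v ω) q (τ + 1) = some u} =
      ∑ v, μ.real {ω | net.freeLink (fun q τ v => sel q τ v ω) q τ = some (v, u)} := by
  have : {ω | net.freeNode (fun q τ v => sel q τ v ω) q (τ + 1) = some u} =
      ⋃ v, {ω | net.freeLink (fun q τ v => sel q τ v ω) q τ = some (v, u)} := by
    ext ω; simp [freeNode_succ_eq_some]
  rw [this, measureReal_def, measure_iUnion, tsum_fintype, ENNReal.toReal_sum]
  · rfl
  · simp
  · intro v w hvw
    rw [Function.onFun, Set.disjoint_left]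
    intro ω h1 h2
    simp only [Set.mem_ofPred_eq] at h1 h2
    rw [h1] at h2
    simp only [Option.some.injEq, Prod.mk.injEq] at h2
    exact hvw h2.1
  · exact fun v => measurableSet_freeLink (fun τ' _ v u => hM.measurableSet_sel _ _ _ _) _

theorem mem_outLinks {l : V × V} {v : V} : l ∈ net.outLinks v ↔ l ∈ net.extLinks ∧ l.1 = v := by
  simp [outLinks]

theorem mem_inLinks {l : V × V} {v : V} : l ∈ net.inLinks v ↔ l ∈ net.extLinks ∧ l.2 = v := by
  simp [inLinks]

theorem deadline_le_dmax (j : J) : net.deadline j ≤ net.dmax :=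
  Finset.le_sup (f := net.deadline) (Finset.mem_univ j)

theorem sum_inLinks (u : V) (g : V × V → ℝ) :
    ∑ l ∈ net.inLinks u, g l = ∑ v, if (v, u) ∈ net.extLinks then g (v, u) else 0 := by
  rw [← Finset.sum_filter]
  refine Finset.sum_nbij' Prod.fst (fun v => (v, u)) ?_ ?_ ?_ ?_ ?_
  · rintro ⟨v, w⟩ h
    obtain ⟨h', rfl⟩ := mem_inLinks.1 h
    simpa using h'
  · intro v h
    exact mem_inLinks.2 ⟨(Finset.mem_filter.1 h).2, rfl⟩
  · rintro ⟨v, w⟩ h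
    obtain ⟨h, rfl⟩ := mem_inLinks.1 h
    rfl
  · exact fun v _ => rfl
  · rintro ⟨v, w⟩ h
    obtain ⟨h, rfl⟩ := mem_inLinks.1 h
    rfl

/-- Without capacity constraints, the link usage of a packet is described by the flow. -/
theorem IsForwardingModel.measureReal_freeLink_eq_flow
    (hM : net.IsForwardingModel μ T N p f a sel prio) (hf : net.FlowFeasible rate ε f)
    {q : Packet J} (hq : q.arrival ∈ Finset.Icc 1 T) (hn : q.index < N q.type) {τ : ℕ}
    (hτ : τ ≤ net.deadline q.type) (l : V × V) :
    μ.real {ω | net.freeLink (fun q τ v => sel q τ v ω) q τ = some l} =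
      if l ∈ net.extLinks then f q.type l τ else 0 := by
  induction τ generalizing l with
  | zero =>
    rw [hM.measureReal_freeLink hq hn hτ]
    simp only [freeNode, Option.some.injEq, forwardProb, Prod.mk.eta, if_true]
    split_ifs with hl
    · by_cases h : net.src q.type = l.1
      · simp [h]
      · rw [hf.source _ l hl (fun h' => h (mem_outLinks.1 h').2.symm), mul_zero]
    · simp
  | succ τ ih =>
    rw [hM.measureReal_freeLink hq hn hτ, hM.measureReal_freeNode_succ]
    simp only [ih (by omega)]
    rw [← sum_inLinks l.1 (fun l => f q.type l τ)]
    have hcons := hf.conservation q.type l.1 (τ + 1) (by simp; omega)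
    rw [Nat.add_sub_cancel] at hcons
    rw [hcons, forwardProb]
    simp only [Prod.mk.eta, Nat.add_eq_zero_iff, one_ne_zero, and_false, if_false]
    split_ifs with hl
    -- By induction and conservation, the probability of being at the node is the denominator of the
    -- forwarding probability. If it vanishes, nonnegativity forces the flow on `l` to vanish too,
    -- so the convention `x / 0 = 0` is harmless.
    · by_cases h : ∑ l ∈ net.outLinks l.1, f q.type l (τ + 1) = 0
      · rw [h, zero_mul]
        have hle := hτ.trans (deadline_le_dmax _)
        exact ((Finset.sum_eq_zero_iff_of_nonneg fun l' hl' =>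
          hf.nonneg _ l' (mem_outLinks.1 hl').1 _ hle).1 h l (mem_outLinks.2 ⟨hl, rfl⟩)).symm
      · exact mul_div_cancel₀ _ h
    · simp

/-- Total mass is preserved from one age to the next: group the flow at age `τ + 1` by the tail of
the link and the flow at age `τ` by its head, then apply conservation node by node. -/
theorem FlowFeasible.sum_extLinks (hf : net.FlowFeasible rate ε f) (j : J) {τ : ℕ}
    (hτ : τ ≤ net.deadline j) :
    ∑ l ∈ net.extLinks, f j l τ = ∑ l ∈ net.outLinks (net.src j), f j l 0 := by
  induction τ with
  | zero =>
    refine (Finset.sum_subset (fun l hl => (mem_outLinks.1 hl).1) fun l hl hl' => ?_).symm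
    exact hf.source j l hl hl'
  | succ τ ih =>
    rw [← ih (by omega), ← Finset.sum_fiberwise net.extLinks Prod.fst,
      ← Finset.sum_fiberwise net.extLinks Prod.snd]
    refine Finset.sum_congr rfl fun v _ => ?_
    have hcons := hf.conservation j v (τ + 1) (by simp; omega)
    rw [Nat.add_sub_cancel] at hcons
    exact hcons.symm

/-- Without capacity constraints, every admitted packet reaches its destination. -/
theorem IsForwardingModel.measureReal_freeNode_deadline
    (hM : net.IsForwardingModel μ T N p f a sel prio) (hf : net.FlowFeasible rate ε f)
    {q : Packet J} (hq : q.arrival ∈ Finset.Icc 1 T) (hn : q.index < N q.type) :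
    μ.real {ω | net.freeNode (fun q τ v => sel q τ v ω) q (net.deadline q.type + 1)
        = some (net.dst q.type)} =
      ∑ l ∈ net.outLinks (net.src q.type), f q.type l 0 := by
  rw [hM.measureReal_freeNode_succ]
  simp only [hM.measureReal_freeLink_eq_flow hf hq hn le_rfl]
  rw [← sum_inLinks (net.dst q.type) (fun l => f q.type l (net.deadline q.type)),
    ← hf.sum_extLinks _ le_rfl]
  -- All flow at the deadline is on links into the destination, so the arriving mass is the total
  -- mass, which equals the admitted mass.
  exact Finset.sum_subset (fun l hl => (mem_inLinks.1 hl).1) fun l hl hl' =>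
    hf.destination _ l hl hl'

end Law

/-! ### Link loads and batches of random size -/

variable (net) in
/-- The packet `q`, moving without capacity constraints, selects the link `l` in slot `s`. -/
def Loads (sel : Packet J → ℕ → V → Option V) (s : ℕ) (l : V × V) (q : Packet J) : Prop :=
  q.arrival ≤ s ∧ s ≤ q.arrival + net.deadline q.type ∧
    net.freeLink sel q (s - q.arrival) = some l

variable (net) in
/-- The probability that a packet of the batch `g` loads the link `l` in slot `s`. -/
def loadProb (f : J → V × V → ℕ → ℝ) (s : ℕ) (l : V × V) (g : J × ℕ) : ℝ :=
  if g.2 ≤ s ∧ s ≤ g.2 + net.deadline g.1 then f g.1 l (s - g.2) else 0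

section

variable {Ω : Type*} {mΩ : MeasurableSpace Ω} {μ : Measure Ω} {T : ℕ}
  {N : J → ℕ} {p : J → unitInterval} {f : J → V × V → ℕ → ℝ}
  {a : J → ℕ → Ω → ℕ} {sel : Packet J → ℕ → V → Ω → Option V}
  {prio : ℕ → Packet J → Ω → ℕ} {rate : J → ℝ} {ε : ℝ}

variable (net) in
/-- The event that the packet `q` loads the link `l` in slot `s`. -/
def loadEvent (sel : Packet J → ℕ → V → Ω → Option V) (s : ℕ) (l : V × V) (q : Packet J) : Set Ω :=
  {ω | net.Loads (fun q τ v => sel q τ v ω) s l q}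

theorem measurableSet_loadEvent (s : ℕ) (l : V × V) (q : Packet J) :
    MeasurableSet[⨆ i ∈ packetInputs q, inputAlgebra a sel i] (net.loadEvent sel s l q) := by
  by_cases h : q.arrival ≤ s ∧ s ≤ q.arrival + net.deadline q.type
  · convert measurableSet_freeLink_packetInputs (net := net) (a := a) (sel := sel) q
      (s - q.arrival) l using 1
    ext ω
    simp [loadEvent, Loads, h.1, h.2]
  · convert @MeasurableSet.empty Ω (⨆ i ∈ packetInputs q, inputAlgebra a sel i)
    ext ω
    simp only [loadEvent, Loads, Set.mem_ofPred_eq, Set.mem_empty_iff_false, iff_false]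
    exact fun h' => h ⟨h'.1, h'.2.1⟩

variable [IsProbabilityMeasure μ]

theorem IsForwardingModel.measureReal_loadEvent
    (hM : net.IsForwardingModel μ T N p f a sel prio) (hf : net.FlowFeasible rate ε f)
    {l : V × V} (hl : l ∈ net.links) (s : ℕ) {g : J × ℕ} (hg : g.2 ∈ Finset.Icc 1 T) {n : ℕ}
    (hn : n < N g.1) : μ.real (net.loadEvent sel s l ⟨g, n⟩) = net.loadProb f s l g := by
  unfold loadProb loadEvent Loads
  split_ifs with h
  · simp only [h.1, h.2, true_and]
    have hl' : l ∈ net.extLinks := Finset.mem_union_left _ hl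
    rw [hM.measureReal_freeLink_eq_flow hf (q := ⟨g, n⟩) hg hn
      (show s - g.2 ≤ net.deadline g.1 by omega), if_pos hl']
  · convert measureReal_empty (μ := μ)
    ext ω
    simp only [Set.mem_ofPred_eq, Set.mem_empty_iff_false, iff_false]
    exact fun h' => h ⟨h'.1, h'.2.1⟩

/-- Mixing a function of the selections of a batch over the size of the batch. -/
theorem IsForwardingModel.integral_batch
    (hM : net.IsForwardingModel μ T N p f a sel prio) {g : J × ℕ} (hg : g.2 ∈ Finset.Icc 1 T)
    {Y : ℕ → Ω → ℝ}
    (hY : ∀ k, Measurable[⨆ i ∈ {i | ∃ n x, i = Sum.inr ((⟨g, n⟩ : Packet J), x)},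
      inputAlgebra a sel i] (Y k))
    (hint : ∀ k, Integrable (Y k) μ) :
    Integrable (fun ω => Y (a g.1 g.2 ω) ω) μ ∧
      ∫ ω, Y (a g.1 g.2 ω) ω ∂μ = ∑ k ∈ Finset.range (N g.1 + 1),
        ((N g.1).choose k * (p g.1 : ℝ) ^ k * (1 - p g.1) ^ (N g.1 - k)) * ∫ ω, Y k ω ∂μ := by
  refine integral_comp_binomial (hM.measurable_arrivals _ _) (hM.arrivals_law _ _ hg)
    (hM.biSup_inputAlgebra_le _) ?_ hY hint
  have hdisj : Disjoint {(Sum.inl g : (J × ℕ) ⊕ (Packet J × ℕ × V))}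
      {i | ∃ n x, i = Sum.inr ((⟨g, n⟩ : Packet J), x)} := by
    rw [Set.disjoint_singleton_left]
    rintro ⟨n, x, h⟩
    simp at h
  have := indep_iSup_of_disjoint (m := inputAlgebra a sel) hM.inputAlgebra_le hM.indep hdisj
  rw [iSup_singleton] at this
  exact this

/-- The number of packets of a batch for which an event depending on their selections occurs. -/
theorem IsForwardingModel.integral_sum_indicator
    (hM : net.IsForwardingModel μ T N p f a sel prio) {g : J × ℕ} (hg : g.2 ∈ Finset.Icc 1 T)
    {D : ℕ → Set Ω}
    (hD : ∀ n, MeasurableSet[⨆ i ∈ packetInputs ⟨g, n⟩, inputAlgebra a sel i] (D n))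
    {π : ℝ} (hπ : ∀ n < N g.1, μ.real (D n) = π) :
    Integrable (fun ω => ∑ n ∈ Finset.range (a g.1 g.2 ω), (D n).indicator (1 : Ω → ℝ) ω) μ ∧
      ∫ ω, ∑ n ∈ Finset.range (a g.1 g.2 ω), (D n).indicator (1 : Ω → ℝ) ω ∂μ =
        N g.1 * p g.1 * π := by
  have hD' : ∀ n, MeasurableSet (D n) := fun n => hM.biSup_inputAlgebra_le _ _ (hD n)
  have hI : ∀ n, Integrable ((D n).indicator (1 : Ω → ℝ)) μ := fun n =>
    (integrable_const 1).indicator (hD' n)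
  obtain ⟨h1, h2⟩ := hM.integral_batch hg
    (Y := fun k ω => ∑ n ∈ Finset.range k, (D n).indicator (1 : Ω → ℝ) ω)
    (fun k => Finset.measurable_fun_sum _ fun n _ => measurable_const.indicator
      (biSup_mono (f := inputAlgebra a sel) (fun i hi => by
        obtain ⟨x, rfl⟩ := hi
        exact ⟨n, x, rfl⟩) _ (hD n)))
    (fun k => integrable_finsetSum _ fun n _ => hI n)
  refine ⟨h1, h2.trans ?_⟩
  -- At `x = 1` the derivative identity is the mean of the binomial law.
  have := sum_binomial_mul_natCast_mul_pow (N g.1) (p g.1) 1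
  rw [sub_self, mul_zero, add_zero, one_pow, mul_one] at this
  rw [← this, Finset.sum_mul]
  refine Finset.sum_congr rfl fun k hk => ?_
  rw [integral_finsetSum _ fun n _ => hI n, one_pow, mul_one, mul_assoc _ (k : ℝ)]
  congr 1
  rw [Finset.sum_congr rfl fun n hn => (integral_indicator_one (hD' n)).trans
    (hπ n (by simp at hn hk; omega))]
  simp

/-- Products over the packets of a batch, and products with one packet marked. -/
theorem IsForwardingModel.integral_prod_batch
    (hM : net.IsForwardingModel μ T N p f a sel prio) {g : J × ℕ} (hg : g.2 ∈ Finset.Icc 1 T)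
    {D : ℕ → Set Ω}
    (hD : ∀ n, MeasurableSet[⨆ i ∈ packetInputs ⟨g, n⟩, inputAlgebra a sel i] (D n))
    {π : ℝ} (hπ : ∀ n < N g.1, μ.real (D n) = π) (ε : ℝ) :
    (Integrable (fun ω => ∏ n ∈ Finset.range (a g.1 g.2 ω),
        (1 + ε * (D n).indicator (1 : Ω → ℝ) ω)) μ ∧
      ∫ ω, ∏ n ∈ Finset.range (a g.1 g.2 ω), (1 + ε * (D n).indicator (1 : Ω → ℝ) ω) ∂μ =
        (1 + p g.1 * (ε * π)) ^ N g.1) ∧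
    (Integrable (fun ω => ∑ n ∈ Finset.range (a g.1 g.2 ω), (D n).indicator (1 : Ω → ℝ) ω *
        ∏ n' ∈ (Finset.range (a g.1 g.2 ω)).erase n,
          (1 + ε * (D n').indicator (1 : Ω → ℝ) ω)) μ ∧
      ∫ ω, ∑ n ∈ Finset.range (a g.1 g.2 ω), (D n).indicator (1 : Ω → ℝ) ω *
        ∏ n' ∈ (Finset.range (a g.1 g.2 ω)).erase n,
          (1 + ε * (D n').indicator (1 : Ω → ℝ) ω) ∂μ =
        N g.1 * p g.1 * (1 + p g.1 * (ε * π)) ^ (N g.1 - 1) * π) := by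
  classical
  have hle := fun n => hM.biSup_inputAlgebra_le (packetInputs (⟨g, n⟩ : Packet J))
  have hD' : ∀ n, MeasurableSet (D n) := fun n => hle n _ (hD n)
  have hI : ∀ n, Integrable ((D n).indicator (1 : Ω → ℝ)) μ := fun n =>
    (integrable_const 1).indicator (hD' n)
  have hdisj : Pairwise (Function.onFun Disjoint
      fun n => packetInputs (V := V) (⟨g, n⟩ : Packet J)) := fun n m hnm =>
    pairwise_disjoint_packetInputs (V := V) (by simpa using hnm)
  have hmI : ∀ n, Measurable[⨆ i ∈ packetInputs ⟨g, n⟩, inputAlgebra a sel i]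
      ((D n).indicator (1 : Ω → ℝ)) := fun n => measurable_const.indicator (hD n)
  have hsub : ∀ n, (⨆ i ∈ packetInputs (⟨g, n⟩ : Packet J), inputAlgebra a sel i) ≤
      ⨆ i ∈ {i | ∃ n x, i = Sum.inr ((⟨g, n⟩ : Packet J), x)}, inputAlgebra a sel i := fun n =>
    biSup_mono (f := inputAlgebra a sel) (fun i hi => by
        obtain ⟨x, rfl⟩ := hi
        exact ⟨n, x, rfl⟩)
  have hmF : ∀ n, Measurable[⨆ i ∈ packetInputs ⟨g, n⟩, inputAlgebra a sel i]
      (fun ω => 1 + ε * (D n).indicator (1 : Ω → ℝ) ω) := fun n =>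
    ((hmI n).const_mul ε).const_add 1
  have hIF : ∀ n, Integrable (fun ω => 1 + ε * (D n).indicator (1 : Ω → ℝ) ω) μ := fun n =>
    (integrable_const 1).add ((hI n).const_mul ε)
  have hvI : ∀ n < N g.1, ∫ ω, (D n).indicator (1 : Ω → ℝ) ω ∂μ = π := fun n hn =>
    (integral_indicator_one (hD' n)).trans (hπ n hn)
  have hvF : ∀ n < N g.1, ∫ ω, (1 + ε * (D n).indicator (1 : Ω → ℝ) ω) ∂μ = 1 + ε * π := by
    intro n hn
    rw [integral_add (integrable_const 1) ((hI n).const_mul ε), integral_const_mul, hvI n hn]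
    simp
  refine ⟨?_, ?_⟩
  · have hp := fun k => integral_finset_prod_of_iIndep hM.inputAlgebra_le hM.indep hdisj hmF hIF
      (Finset.range k)
    obtain ⟨h1, h2⟩ := hM.integral_batch hg
      (Y := fun k ω => ∏ n ∈ Finset.range k, (1 + ε * (D n).indicator (1 : Ω → ℝ) ω))
      (fun k => Finset.measurable_fun_prod _ fun n _ => (hmF n).mono (hsub n) le_rfl)
      (fun k => (hp k).1)
    refine ⟨h1, h2.trans ?_⟩
    have := sum_binomial_mul_pow (N g.1) (p g.1) (1 + ε * π)
    rw [add_sub_cancel_left] at this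
    rw [← this]
    refine Finset.sum_congr rfl fun k hk => ?_
    rw [(hp k).2, Finset.prod_congr rfl fun n hn => hvF n (by simp at hn hk; omega)]
    simp
  · -- the factor of the marked packet is its indicator
    let X : ℕ → ℕ → Ω → ℝ := fun n m ω => if m = n then (D m).indicator (1 : Ω → ℝ) ω
      else 1 + ε * (D m).indicator (1 : Ω → ℝ) ω
    have hX : ∀ k, ∀ n ∈ Finset.range k, ∀ ω, (D n).indicator (1 : Ω → ℝ) ω *
        ∏ n' ∈ (Finset.range k).erase n, (1 + ε * (D n').indicator (1 : Ω → ℝ) ω) =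
        ∏ m ∈ Finset.range k, X n m ω := by
      intro k n hn ω
      rw [← Finset.mul_prod_erase _ _ hn]
      simp only [X, if_true]
      congr 1
      exact Finset.prod_congr rfl fun m hm => by rw [if_neg (Finset.ne_of_mem_erase hm)]
    have hmX : ∀ n m, Measurable[⨆ i ∈ packetInputs ⟨g, m⟩, inputAlgebra a sel i] (X n m) := by
      intro n m
      by_cases h : m = n <;> simp only [X, h, if_true, if_false]
      · exact h ▸ hmI m
      · exact hmF m
    have hIX : ∀ n m, Integrable (X n m) μ := by
      intro n m
      by_cases h : m = n <;> simp only [X, h, if_true, if_false]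
      · exact hI n
      · exact hIF m
    have hp := fun k n => integral_finset_prod_of_iIndep hM.inputAlgebra_le hM.indep hdisj (hmX n)
      (hIX n) (Finset.range k)
    obtain ⟨h1, h2⟩ := hM.integral_batch hg
      (Y := fun k ω => ∑ n ∈ Finset.range k, ∏ m ∈ Finset.range k, X n m ω)
      (fun k => Finset.measurable_fun_sum _ fun n _ =>
        Finset.measurable_fun_prod _ fun m _ => (hmX n m).mono (hsub m) le_rfl)
      (fun k => integrable_finsetSum _ fun n _ => (hp k n).1)
    have hE : (fun ω => ∑ n ∈ Finset.range (a g.1 g.2 ω), (D n).indicator (1 : Ω → ℝ) ω *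
        ∏ n' ∈ (Finset.range (a g.1 g.2 ω)).erase n,
          (1 + ε * (D n').indicator (1 : Ω → ℝ) ω)) = fun ω =>
        ∑ n ∈ Finset.range (a g.1 g.2 ω), ∏ m ∈ Finset.range (a g.1 g.2 ω), X n m ω :=
      funext fun ω => Finset.sum_congr rfl fun n hn => hX _ n hn ω
    rw [hE]
    refine ⟨h1, h2.trans ?_⟩
    have := sum_binomial_mul_natCast_mul_pow (N g.1) (p g.1) (1 + ε * π)
    rw [add_sub_cancel_left] at this
    rw [← this, Finset.sum_mul]
    refine Finset.sum_congr rfl fun k hk => ?_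
    rw [integral_finsetSum _ fun n _ => (hp k n).1, mul_assoc _ (_ * _)]
    congr 1
    have hterm : ∀ n ∈ Finset.range k, ∫ ω, ∏ m ∈ Finset.range k, X n m ω ∂μ =
        (1 + ε * π) ^ (k - 1) * π := by
      intro n hn
      have hkN : k ≤ N g.1 := by simp at hk; omega
      rw [(hp k n).2, ← Finset.mul_prod_erase _ _ hn, Finset.prod_congr rfl (g := fun _ => 1 + ε * π)]
      · simp only [X, if_true]
        rw [hvI n (by simp at hn; omega), Finset.prod_const, Finset.card_erase_of_mem hn,
          Finset.card_range, mul_comm]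
      · intro m hm
        simp only [X, if_neg (Finset.ne_of_mem_erase hm)]
        exact hvF m (by have := Finset.mem_of_mem_erase hm; simp at this; omega)
    rw [Finset.sum_congr rfl hterm]
    simp [mul_assoc]

end

end PacketNetwork

/-! ### Chernoff bound for overloaded links -/

theorem one_add_pow_le_exp {x : ℝ} (hx : 0 ≤ x) (n : ℕ) : (1 + x) ^ n ≤ Real.exp (n * x) := by
  rw [Real.exp_nat_mul]
  exact pow_le_pow_left₀ (by linarith) (by linarith [Real.add_one_le_exp x]) n

namespace PacketNetwork

variable {V J : Type*} [Fintype V] [DecidableEq V] [Fintype J] {net : PacketNetwork V J}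

section

variable {Ω : Type*} {mΩ : MeasurableSpace Ω} {μ : Measure Ω} {T : ℕ}
  {N : J → ℕ} {p : J → unitInterval} {f : J → V × V → ℕ → ℝ}
  {a : J → ℕ → Ω → ℕ} {sel : Packet J → ℕ → V → Ω → Option V}
  {prio : ℕ → Packet J → Ω → ℕ} {ε : ℝ}

/-- The total rate at which a link is loaded in a slot respects the capacity constraint. -/
theorem FlowFeasible.sum_loadProb_le {rate : J → ℝ} (hrate : ∀ j, 0 ≤ rate j)
    (hf : net.FlowFeasible rate ε f) {l : V × V} (hl : l ∈ net.links) (s : ℕ) :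
    ∑ g ∈ Finset.univ ×ˢ Finset.Icc 1 T, rate g.1 * net.loadProb f s l g ≤
      net.cap l / (1 + ε) := by
  refine le_trans ?_ (hf.capacity l hl)
  rw [Finset.sum_product]
  refine Finset.sum_le_sum fun j _ => ?_
  simp only [loadProb, mul_ite, mul_zero]
  rw [← Finset.sum_filter]
  -- For a fixed type and slot `s`, different arrival slots mean different ages `s - t`, so the load
  -- in one slot is part of the sum over ages in the capacity constraint.
  have hinj : Set.InjOn (fun t => s - t)
      ((Finset.Icc 1 T).filter fun t => t ≤ s ∧ s ≤ t + net.deadline j) := by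
    intro t ht t' ht' h
    simp at ht ht' h
    omega
  rw [← Finset.sum_image (f := fun τ => rate j * f j l τ) hinj]
  refine Finset.sum_le_sum_of_subset_of_nonneg ?_ fun τ hτ _ => ?_
  · intro τ hτ
    simp only [Finset.mem_image, Finset.mem_filter, Finset.mem_range] at hτ ⊢
    obtain ⟨t, ht, rfl⟩ := hτ
    omega
  · exact mul_nonneg (hrate j) (hf.nonneg j l (Finset.mem_union_left _ hl) τ
      ((Nat.lt_succ_iff.1 (Finset.mem_range.1 hτ)).trans (deadline_le_dmax j)))

theorem FlowFeasible.loadProb_nonneg {rate : J → ℝ}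
    (hf : net.FlowFeasible rate ε f) {l : V × V} (hl : l ∈ net.links) (s : ℕ) (g : J × ℕ) :
    0 ≤ net.loadProb f s l g := by
  unfold loadProb
  split_ifs with h
  · exact hf.nonneg _ l (Finset.mem_union_left _ hl) _
      ((show s - g.2 ≤ net.deadline g.1 by omega).trans (deadline_le_dmax _))
  · exact le_rfl

variable (net) in
/-- Without capacity constraints, in slot `s` the link `l` would be selected by at least `cap l`
packets other than `q`. -/
def Overloaded (T : ℕ) (a : J → ℕ → ℕ) (sel : Packet J → ℕ → V → Option V) (s : ℕ) (l : V × V)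
    (q : Packet J) : Prop :=
  ∃ R : Finset (Packet J), R ⊆ packets T a ∧ q ∉ R ∧ (∀ r ∈ R, net.Loads sel s l r) ∧
    net.cap l ≤ R.card

-- Markov's inequality in pointwise form. If `cap l` other packets load the link, the product of `1
-- + ε * 1_load` over the other packets has at least `cap l` factors `1 + ε`, and the remaining
-- factors are at least `1`. Leaving the marked packet out of the product keeps its own indicator
-- independent of it, and splitting by batches prepares the use of independence.
open Classical in
theorem sum_indicator_overloaded_le (hε : 0 < ε) {T : ℕ} (a : J → ℕ → ℕ)
    (sel : Packet J → ℕ → V → Option V) (s : ℕ) (l : V × V) {g : J × ℕ}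
    (hg : g ∈ Finset.univ ×ˢ Finset.Icc 1 T) :
    (∑ n ∈ Finset.range (a g.1 g.2), if net.Loads sel s l ⟨g, n⟩ ∧
        net.Overloaded T a sel s l ⟨g, n⟩ then (1 : ℝ) else 0) ≤
      ((1 + ε) ^ net.cap l)⁻¹ *
        ((∑ n ∈ Finset.range (a g.1 g.2), (if net.Loads sel s l ⟨g, n⟩ then (1 : ℝ) else 0) *
          ∏ n' ∈ (Finset.range (a g.1 g.2)).erase n,
            (1 + ε * if net.Loads sel s l ⟨g, n'⟩ then (1 : ℝ) else 0)) *
        ∏ h ∈ (Finset.univ ×ˢ Finset.Icc 1 T).erase g, ∏ n' ∈ Finset.range (a h.1 h.2),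
          (1 + ε * if net.Loads sel s l ⟨h, n'⟩ then (1 : ℝ) else 0)) := by
  rw [Finset.sum_mul, Finset.mul_sum]
  refine Finset.sum_le_sum fun n hn => ?_
  let F : Packet J → ℝ := fun r => 1 + ε * if net.Loads sel s l r then (1 : ℝ) else 0
  have hF1 : ∀ r, 1 ≤ F r := fun r => by
    simp only [F]; split_ifs <;> simp [hε.le]
  have hF0 : ∀ r, 0 < F r := fun r => one_pos.trans_le (hF1 r)
  have hq : (⟨g, n⟩ : Packet J) ∈ packets T a := by
    simp only [packets, Finset.mem_sigma]
    exact ⟨hg, hn⟩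
  have hsplit : ∏ r ∈ (packets T a).erase ⟨g, n⟩, F r =
      (∏ n' ∈ (Finset.range (a g.1 g.2)).erase n, F ⟨g, n'⟩) *
        ∏ h ∈ (Finset.univ ×ˢ Finset.Icc 1 T).erase g, ∏ n' ∈ Finset.range (a h.1 h.2),
          F ⟨h, n'⟩ := by
    have h1 := Finset.mul_prod_erase _ F hq
    have h2 : ∏ r ∈ packets T a, F r = ∏ h ∈ Finset.univ ×ˢ Finset.Icc 1 T,
      ∏ n' ∈ Finset.range (a h.1 h.2), F ⟨h, n'⟩ := by rw [packets, Finset.prod_sigma]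
    rw [← Finset.mul_prod_erase _ _ hg, ← Finset.mul_prod_erase _ _ hn, ← h1, mul_assoc] at h2
    exact mul_left_cancel₀ (hF0 _).ne' h2
  have hrest : 0 ≤ ∏ r ∈ (packets T a).erase ⟨g, n⟩, F r :=
    Finset.prod_nonneg fun r _ => (hF0 r).le
  rw [mul_assoc, ← hsplit]
  have hpow : 0 < (1 + ε) ^ net.cap l := by positivity
  by_cases h : net.Loads sel s l ⟨g, n⟩
  · by_cases h' : net.Overloaded T a sel s l ⟨g, n⟩
    · simp only [h, h', and_self, if_true, one_mul]
      obtain ⟨R, hR, hqR, hRl, hcard⟩ := h'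
      rw [inv_mul_eq_div, one_le_div hpow]
      calc (1 + ε) ^ net.cap l ≤ (1 + ε) ^ R.card := pow_le_pow_right₀ (by linarith) hcard
        _ = ∏ r ∈ R, F r := by
          rw [Finset.prod_congr rfl (g := fun _ => 1 + ε), Finset.prod_const]
          intro r hr
          simp [F, hRl r hr]
        _ ≤ _ := Finset.prod_le_prod_of_subset_of_one_le
          (fun r hr => Finset.mem_erase.2 ⟨ne_of_mem_of_not_mem hr hqR, hR hr⟩)
          (fun r _ => (hF0 r).le) fun r _ _ => hF1 r
    · simp only [h', and_false, if_false]
      positivity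
  · simp [h]

open Classical in
/-- The Chernoff bound: the expected number of packets of a batch that find the link `l` overloaded
in slot `s`. -/
theorem IsForwardingModel.exists_overload_bound [IsProbabilityMeasure μ]
    (hM : net.IsForwardingModel μ T N p f a sel prio)
    (hf : net.FlowFeasible (fun j => (N j : ℝ) * (p j : ℝ)) ε f) (hε : 0 < ε)
    {l : V × V} (hl : l ∈ net.links) (s : ℕ) {g : J × ℕ} (hg : g.2 ∈ Finset.Icc 1 T) :
    ∃ Q : Ω → ℝ, Integrable Q μ ∧
      (∀ ω, (∑ n ∈ Finset.range (a g.1 g.2 ω),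
        if net.Loads (fun q τ v => sel q τ v ω) s l ⟨g, n⟩ ∧
          net.Overloaded T (fun j t => a j t ω) (fun q τ v => sel q τ v ω) s l ⟨g, n⟩
        then (1 : ℝ) else 0) ≤ Q ω) ∧
      ∫ ω, Q ω ∂μ ≤ N g.1 * p g.1 * net.loadProb f s l g *
        Real.exp (-(net.cap l * (ε / (1 + ε)) ^ 2 / 2)) := by
  have hgm : g ∈ (Finset.univ : Finset J) ×ˢ Finset.Icc 1 T := by simpa using hg
  have hp0 : ∀ j, (0 : ℝ) ≤ p j := fun j => (p j).2.1
  have hind : ∀ r ω, (if net.Loads (fun q τ v => sel q τ v ω) s l r then (1 : ℝ) else 0) =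
      (net.loadEvent sel s l r).indicator 1 ω := fun r ω => by
    by_cases h : net.Loads (fun q τ v => sel q τ v ω) s l r <;>
      simp [Set.indicator, loadEvent, h]
  -- one factor per batch; outside the horizon it is constant
  let X : J × ℕ → Ω → ℝ := fun h ω =>
    if h.2 ∈ Finset.Icc 1 T then
      if h = g then ∑ n ∈ Finset.range (a h.1 h.2 ω),
        (net.loadEvent sel s l ⟨h, n⟩).indicator (1 : Ω → ℝ) ω *
          ∏ n' ∈ (Finset.range (a h.1 h.2 ω)).erase n,
            (1 + ε * (net.loadEvent sel s l ⟨h, n'⟩).indicator (1 : Ω → ℝ) ω)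
      else ∏ n ∈ Finset.range (a h.1 h.2 ω),
        (1 + ε * (net.loadEvent sel s l ⟨h, n⟩).indicator (1 : Ω → ℝ) ω)
    else 1
  have hbatch := fun (h : J × ℕ) (hh : h.2 ∈ Finset.Icc 1 T) => hM.integral_prod_batch hh
    (D := fun n => net.loadEvent sel s l ⟨h, n⟩) (fun n => measurableSet_loadEvent s l ⟨h, n⟩)
    (fun n hn => hM.measureReal_loadEvent hf hl s hh hn) ε
  have hXint : ∀ h, Integrable (X h) μ := by
    intro h
    by_cases hh : h.2 ∈ Finset.Icc 1 T
    · by_cases hhg : h = g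
      · simp only [X, if_pos hh, if_pos hhg]
        exact (hbatch h hh).2.1
      · simp only [X, if_pos hh, if_neg hhg]
        exact (hbatch h hh).1.1
    · simp only [X, if_neg hh]
      exact integrable_const 1
  have hXmeas : ∀ h, Measurable[⨆ i ∈ batchInputs h, inputAlgebra a sel i] (X h) := by
    intro h
    have ha : Measurable[⨆ i ∈ batchInputs h, inputAlgebra a sel i] (a h.1 h.2) :=
      measurable_arrival_of_mem (show _ ∈ batchInputs h from Or.inl rfl)
    have hE : ∀ n, Measurable[⨆ i ∈ batchInputs h, inputAlgebra a sel i]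
        ((net.loadEvent sel s l ⟨h, n⟩).indicator (1 : Ω → ℝ)) := fun n =>
      measurable_const.indicator (biSup_mono (f := inputAlgebra a sel)
        (fun i hi => packetInputs_subset_batchInputs h n hi) _ (measurableSet_loadEvent s l ⟨h, n⟩))
    have hF : ∀ n, Measurable[⨆ i ∈ batchInputs h, inputAlgebra a sel i]
        (fun ω => 1 + ε * (net.loadEvent sel s l ⟨h, n⟩).indicator (1 : Ω → ℝ) ω) := fun n =>
      ((hE n).const_mul ε).const_add 1
    -- Evaluation at the random batch size preserves measurability because the index ranges over a
    -- countable set.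
    have key : ∀ Y : ℕ → Ω → ℝ, (∀ k, Measurable[⨆ i ∈ batchInputs h, inputAlgebra a sel i] (Y k)) →
        Measurable[⨆ i ∈ batchInputs h, inputAlgebra a sel i] fun ω => Y (a h.1 h.2 ω) ω := by
      intro Y hY
      let _ := ⨆ i ∈ batchInputs h, inputAlgebra a sel i
      exact (measurable_from_prod_countable_right (f := fun x : ℕ × Ω => Y x.1 x.2) hY).comp
        (ha.prodMk measurable_id)
    by_cases hh : h.2 ∈ Finset.Icc 1 T
    · by_cases hhg : h = g
      · simp only [X, if_pos hh, if_pos hhg]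
        exact key (fun k ω => ∑ n ∈ Finset.range k,
          (net.loadEvent sel s l ⟨h, n⟩).indicator (1 : Ω → ℝ) ω *
          ∏ n' ∈ (Finset.range k).erase n,
            (1 + ε * (net.loadEvent sel s l ⟨h, n'⟩).indicator (1 : Ω → ℝ) ω)) fun k =>
          Finset.measurable_fun_sum _ fun n _ => (hE n).mul
            (Finset.measurable_fun_prod _ fun n' _ => hF n')
      · simp only [X, if_pos hh, if_neg hhg]
        exact key (fun k ω => ∏ n ∈ Finset.range k,
          (1 + ε * (net.loadEvent sel s l ⟨h, n⟩).indicator (1 : Ω → ℝ) ω)) fun k =>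
          Finset.measurable_fun_prod _ fun n _ => hF n
    · simp only [X, if_neg hh]
      exact measurable_const
  obtain ⟨hI, hv⟩ := integral_finset_prod_of_iIndep hM.inputAlgebra_le hM.indep
    pairwise_disjoint_batchInputs hXmeas hXint (Finset.univ ×ˢ Finset.Icc 1 T)
  refine ⟨fun ω => ((1 + ε) ^ net.cap l)⁻¹ * ∏ h ∈ Finset.univ ×ˢ Finset.Icc 1 T, X h ω,
    hI.const_mul _, fun ω => ?_, ?_⟩
  · refine (sum_indicator_overloaded_le hε (fun j t => a j t ω) (fun q τ v => sel q τ v ω) s l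
      hgm).trans_eq ?_
    beta_reduce
    rw [← Finset.mul_prod_erase _ _ hgm]
    simp only [hind]
    congr 2
    · simp only [X, if_pos hg, if_true]
    · refine Finset.prod_congr rfl fun h hh => ?_
      have h1 := Finset.mem_erase.1 hh
      simp only [X, if_neg h1.1, if_pos (Finset.mem_product.1 h1.2).2]
  · rw [integral_const_mul, hv, ← Finset.mul_prod_erase _ _ hgm]
    have hπ := fun h => hf.loadProb_nonneg hl s h
    -- The marked batch has exponent `N - 1` for the unmarked packets. Raising it to `N` gives this
    -- batch the same exponential as the others, so that the exponents add up to `ε` times the full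
    -- expected load of the link.
    have hgv : ∫ ω, X g ω ∂μ ≤ N g.1 * p g.1 * net.loadProb f s l g *
        Real.exp (ε * (N g.1 * p g.1 * net.loadProb f s l g)) := by
      simp only [X, if_pos hg, if_true]
      rw [(hbatch g hg).2.2, mul_right_comm]
      refine mul_le_mul_of_nonneg_left ?_
        (mul_nonneg (mul_nonneg (Nat.cast_nonneg _) (hp0 _)) (hπ g))
      have hx : 0 ≤ p g.1 * (ε * net.loadProb f s l g) :=
        mul_nonneg (hp0 _) (mul_nonneg hε.le (hπ g))
      calc (1 + p g.1 * (ε * net.loadProb f s l g)) ^ (N g.1 - 1)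
          ≤ (1 + p g.1 * (ε * net.loadProb f s l g)) ^ N g.1 :=
            pow_le_pow_right₀ (by linarith) (Nat.sub_le _ _)
        _ ≤ Real.exp (N g.1 * (p g.1 * (ε * net.loadProb f s l g))) :=
            one_add_pow_le_exp hx _
        _ = _ := by congr 1; ring
    have hhv : ∀ h ∈ (Finset.univ ×ˢ Finset.Icc 1 T).erase g,
        0 ≤ ∫ ω, X h ω ∂μ ∧
        ∫ ω, X h ω ∂μ ≤ Real.exp (ε * (N h.1 * p h.1 * net.loadProb f s l h)) := by
      intro h hh
      have h1 := Finset.mem_erase.1 hh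
      have h2 := (Finset.mem_product.1 h1.2).2
      simp only [X, if_neg h1.1, if_pos h2]
      rw [(hbatch h h2).1.2]
      have hx : 0 ≤ p h.1 * (ε * net.loadProb f s l h) :=
        mul_nonneg (hp0 _) (mul_nonneg hε.le (hπ h))
      refine ⟨by positivity, ?_⟩
      exact (one_add_pow_le_exp hx _).trans_eq (by congr 1; ring)
    have hA : (0 : ℝ) ≤ N g.1 * p g.1 * net.loadProb f s l g :=
      mul_nonneg (mul_nonneg (Nat.cast_nonneg _) (hp0 _)) (hπ g)
    have hrate := hf.sum_loadProb_le (T := T)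
      (fun j => mul_nonneg (Nat.cast_nonneg _) (hp0 j)) hl s
    have h1ε : 0 < (1 + ε) ^ net.cap l := by positivity
    calc ((1 + ε) ^ net.cap l)⁻¹ * ((∫ ω, X g ω ∂μ) *
          ∏ h ∈ (Finset.univ ×ˢ Finset.Icc 1 T).erase g, ∫ ω, X h ω ∂μ)
        ≤ ((1 + ε) ^ net.cap l)⁻¹ * ((N g.1 * p g.1 * net.loadProb f s l g *
          Real.exp (ε * (N g.1 * p g.1 * net.loadProb f s l g))) *
          ∏ h ∈ (Finset.univ ×ˢ Finset.Icc 1 T).erase g,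
            Real.exp (ε * (N h.1 * p h.1 * net.loadProb f s l h))) := by
          refine mul_le_mul_of_nonneg_left ?_ (by positivity)
          exact mul_le_mul hgv (Finset.prod_le_prod (fun h hh => (hhv h hh).1)
            fun h hh => (hhv h hh).2) (Finset.prod_nonneg fun h hh => (hhv h hh).1)
            (mul_nonneg hA (Real.exp_pos _).le)
      _ = N g.1 * p g.1 * net.loadProb f s l g * (Real.exp (ε *
          ∑ h ∈ Finset.univ ×ˢ Finset.Icc 1 T, (N h.1 : ℝ) * p h.1 * net.loadProb f s l h) /
            (1 + ε) ^ net.cap l) := by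
          rw [mul_assoc (N g.1 * p g.1 * net.loadProb f s l g : ℝ), Finset.mul_prod_erase _
            (fun h => Real.exp (ε * (N h.1 * p h.1 * net.loadProb f s l h))) hgm,
            ← Real.exp_sum, Finset.mul_sum]
          ring
      _ ≤ _ := by
          refine mul_le_mul_of_nonneg_left ?_ hA
          refine le_trans ?_ (exp_div_one_add_pow_le hε (net.cap l))
          gcongr

end

/-! ### Comparison of the forwarding with the unconstrained motion -/

section Coupling

variable {T : ℕ} {a : J → ℕ → ℕ} {sel : Packet J → ℕ → V → Option V} {prio : ℕ → Packet J → ℕ}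

theorem freeNode_of_nodeIn {s : ℕ} {prev : Packet J → Option V} {q : Packet J} {v : V}
    (hprev : ∀ v, prev q = some v → net.freeNode sel q (s - q.arrival + 1) = some v)
    (h : net.nodeIn T a prev (s + 1) q = some v) :
    q.arrival ≤ s + 1 ∧ s + 1 ≤ q.arrival + net.deadline q.type ∧
      net.freeNode sel q (s + 1 - q.arrival) = some v := by
  unfold nodeIn at h
  split_ifs at h with h1 h2 h3
  · rw [← h2, Nat.sub_self]
    exact ⟨le_rfl, by omega, h⟩
  · refine ⟨h3.1.le, h3.2, ?_⟩
    rw [show s + 1 - q.arrival = s - q.arrival + 1 by omega]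
    exact hprev v h

theorem loads_of_request {s : ℕ} {prev : Packet J → Option V} {q : Packet J} {l : V × V}
    (hprev : ∀ v, prev q = some v → net.freeNode sel q (s - q.arrival + 1) = some v)
    (h : net.request T a sel prev (s + 1) q = some l) : net.Loads sel (s + 1) l q := by
  simp only [request, Option.bind_eq_some_iff, Option.map_eq_some_iff] at h
  obtain ⟨v, hv, u, hu, rfl⟩ := h
  obtain ⟨h1, h2, h3⟩ := freeNode_of_nodeIn hprev hv
  exact ⟨h1, h2, freeLink_eq_some.2 ⟨h3, hu⟩⟩

/-- Congestion can only remove a packet, never divert it. The end of slot `s` is the beginning of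
age `s - q.arrival + 1`; the truncated subtraction does no harm, since before its arrival a packet
is nowhere. -/
theorem freeNode_of_endNode {s : ℕ} {q : Packet J} {v : V}
    (h : net.endNode T a sel prio s q = some v) :
    net.freeNode sel q (s - q.arrival + 1) = some v := by
  induction s generalizing v with
  | zero => simp [endNode] at h
  | succ s ih =>
    simp only [endNode, slotStep, Option.bind_eq_some_iff] at h
    obtain ⟨l, hl, h⟩ := h
    split_ifs at h with hc
    · obtain ⟨_, _, h3⟩ := loads_of_request (fun v hv => ih hv) hl
      simp only [Option.some.injEq] at h
      exact freeNode_succ_eq_some.2 ⟨l.1, by rw [h3, ← h]⟩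

/-- A packet that never finds its link overloaded moves as without capacity constraints. -/
theorem endNode_eq_freeNode {q : Packet J} (hq : q ∈ packets T a)
    (hfree : ∀ τ ≤ net.deadline q.type, ∀ l ∈ net.links, net.freeLink sel q τ = some l →
      ¬ net.Overloaded T a sel (q.arrival + τ) l q) {τ : ℕ} (hτ : τ ≤ net.deadline q.type) :
    net.endNode T a sel prio (q.arrival + τ) q = net.freeNode sel q (τ + 1) := by
  classical
  have harr : 1 ≤ q.arrival := by
    simp only [packets, Finset.mem_sigma, Finset.mem_product, Finset.mem_Icc] at hq
    exact hq.1.2.1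
  have hprev : ∀ s r v, net.endNode T a sel prio s r = some v →
      net.freeNode sel r (s - r.arrival + 1) = some v := fun s r v h => freeNode_of_endNode h
  have hstep : ∀ s, ∀ τ ≤ net.deadline q.type, q.arrival + τ = s + 1 →
      net.nodeIn T a (net.endNode T a sel prio s) (s + 1) q = net.freeNode sel q τ →
      net.endNode T a sel prio (s + 1) q = net.freeNode sel q (τ + 1) := by
    intro s τ hτ hs hnode
    have hage : s + 1 - q.arrival = τ := by omega
    have hreq : net.request T a sel (net.endNode T a sel prio s) (s + 1) q =
        net.freeLink sel q τ := by
      rw [request, hnode, hage, freeLink]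
    simp only [endNode, slotStep, hreq]
    cases hl : net.freeLink sel q τ with
    | none =>
      cases hn : net.freeNode sel q (τ + 1) with
      | none => rfl
      | some u =>
        obtain ⟨v, hv⟩ := freeNode_succ_eq_some.1 hn
        simp [hl] at hv
    | some l =>
      rw [freeNode_succ_eq_some.2 ⟨l.1, hl⟩, Option.bind_some, if_pos]
      intro hlink
      by_contra hcard
      -- If the link refuses `q`, the packets processed before it on that link witness the overload:
      -- by the coupling each of them also loads `l` in the free motion.
      refine hfree τ hτ l hlink hl ⟨_, Finset.filter_subset _ _, ?_, ?_, not_lt.1 hcard⟩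
      · simp
      · intro r hr
        rw [hs]
        exact loads_of_request (fun v => hprev s r v) (Finset.mem_filter.1 hr).2.1
  induction τ with
  | zero =>
    obtain ⟨s, hs⟩ : ∃ s, q.arrival = s + 1 := ⟨q.arrival - 1, by omega⟩
    rw [add_zero, hs]
    refine hstep s 0 hτ hs ?_
    rw [nodeIn, if_pos hq, if_pos hs.symm, freeNode]
  | succ τ ih =>
    refine hstep (q.arrival + τ) (τ + 1) hτ rfl ?_
    rw [nodeIn, if_pos hq, if_neg (by omega), if_pos (by omega)]
    exact ih (by omega)

theorem freeLink_ne_none_of_freeNode {q : Packet J} {τ τ' : ℕ} (hτ : τ < τ')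
    (h : net.freeNode sel q τ' ≠ none) : net.freeLink sel q τ ≠ none := by
  induction τ', hτ using Nat.le_induction with
  | base =>
    intro h'
    obtain ⟨u, hu⟩ := Option.ne_none_iff_exists'.1 h
    obtain ⟨v, hv⟩ := freeNode_succ_eq_some.1 hu
    simp [h'] at hv
  | succ τ' _ ih =>
    refine ih fun h' => h ?_
    simp [freeNode, h']

end Coupling

/-! ### The length of the routes taken -/

/-- A packet that reaches its destination has followed a route-schedule. -/
theorem sum_freeLink_le_maxRouteLength {sel : Packet J → ℕ → V → Option V} {q : Packet J}
    (hext : ∀ τ ≤ net.deadline q.type, ∀ l, net.freeLink sel q τ = some l → l ∈ net.extLinks)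
    (hdst : net.freeNode sel q (net.deadline q.type + 1) = some (net.dst q.type)) :
    (∑ τ ∈ Finset.range (net.deadline q.type + 1), ∑ l ∈ net.links,
      if net.freeLink sel q τ = some l then (1 : ℝ) else 0) ≤ net.maxRouteLength := by
  classical
  have hsome : ∀ τ : Fin (net.deadline q.type + 1), ∃ l, net.freeLink sel q τ = some l := fun τ =>
    Option.ne_none_iff_exists'.1 (freeLink_ne_none_of_freeNode τ.2 (by simp [hdst]))
  choose k hk using hsome
  have hnode : ∀ τ : Fin (net.deadline q.type + 1),
      net.freeNode sel q (τ + 1) = some (k τ).2 := fun τ =>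
    freeNode_succ_eq_some.2 ⟨(k τ).1, hk τ⟩
  have hroute : k ∈ net.routes q.type := by
    simp only [routes, Finset.mem_filter, Finset.mem_univ, true_and]
    have hmem : ∀ τ, k τ ∈ net.extLinks := fun τ => hext τ (Nat.lt_succ_iff.1 τ.2) _ (hk τ)
    refine ⟨hmem, fun τ => ?_, mem_outLinks.2 ⟨hmem _, ?_⟩, mem_inLinks.2 ⟨hmem _, ?_⟩⟩
    · have h1 := hnode τ.castSucc
      have h2 := (freeLink_eq_some.1 (hk τ.succ)).1
      simp only [Fin.val_castSucc, Fin.val_succ] at h1 h2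
      rw [h1] at h2
      exact Option.some.inj h2
    · have h2 := (freeLink_eq_some.1 (hk 0)).1
      simp only [Fin.val_zero, freeNode] at h2
      exact (Option.some.inj h2).symm
    · have h1 := hnode (Fin.last _)
      simp only [Fin.val_last] at h1
      rw [hdst] at h1
      exact (Option.some.inj h1).symm
  have hcount : (∑ τ ∈ Finset.range (net.deadline q.type + 1), ∑ l ∈ net.links,
      if net.freeLink sel q τ = some l then (1 : ℝ) else 0) =
      (Finset.univ.filter fun τ => k τ ∈ net.links).card := by
    rw [Finset.sum_range, Finset.card_filter, Nat.cast_sum]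
    refine Finset.sum_congr rfl fun τ _ => ?_
    simp [hk τ]
  rw [hcount]
  have h1 := Finset.le_sup (f := fun k : Fin (net.deadline q.type + 1) → V × V =>
    (Finset.univ.filter (fun τ => k τ ∈ net.links)).card) hroute
  have h2 := Finset.le_sup (f := fun j => (net.routes j).sup
    fun k => (Finset.univ.filter (fun τ => k τ ∈ net.links)).card) (Finset.mem_univ q.type)
  exact_mod_cast h1.trans h2

theorem IsForwardingModel.sum_flow_le_maxRouteLength_mul {Ω : Type*} {mΩ : MeasurableSpace Ω}
    {μ : Measure Ω} [IsProbabilityMeasure μ] {T : ℕ} {N : J → ℕ} {p : J → unitInterval}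
    {f : J → V × V → ℕ → ℝ} {a : J → ℕ → Ω → ℕ} {sel : Packet J → ℕ → V → Ω → Option V}
    {prio : ℕ → Packet J → Ω → ℕ} {rate : J → ℝ} {ε : ℝ}
    (hM : net.IsForwardingModel μ T N p f a sel prio) (hf : net.FlowFeasible rate ε f)
    {q : Packet J} (hq : q.arrival ∈ Finset.Icc 1 T) (hn : q.index < N q.type) :
    ∑ τ ∈ Finset.range (net.deadline q.type + 1), ∑ l ∈ net.links, f q.type l τ ≤
      net.maxRouteLength * ∑ l ∈ net.outLinks (net.src q.type), f q.type l 0 := by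
  set d := net.deadline q.type with hd
  let E : ℕ → V × V → Set Ω := fun τ l =>
    {ω | net.freeLink (fun q τ v => sel q τ v ω) q τ = some l}
  let D : Set Ω := {ω | net.freeNode (fun q τ v => sel q τ v ω) q (d + 1) = some (net.dst q.type)}
  have hE : ∀ τ l, MeasurableSet (E τ l) := fun τ l =>
    measurableSet_freeLink (fun _ _ _ _ => hM.measurableSet_sel _ _ _ _) l
  have hD : MeasurableSet D :=
    measurableSet_freeNode (fun _ _ _ _ => hM.measurableSet_sel _ _ _ _) _
  have hEv : ∀ τ ≤ d, ∀ l, μ.real (E τ l) = if l ∈ net.extLinks then f q.type l τ else 0 :=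
    fun τ hτ l => hM.measureReal_freeLink_eq_flow hf hq hn hτ l
  have hDv : μ.real D = ∑ l ∈ net.outLinks (net.src q.type), f q.type l 0 :=
    hM.measureReal_freeNode_deadline hf hq hn
  have hext : ∀ᵐ ω ∂μ, ∀ τ ≤ d, ∀ l,
      net.freeLink (fun q τ v => sel q τ v ω) q τ = some l → l ∈ net.extLinks := by
    rw [ae_all_iff]
    intro τ
    by_cases hτ : τ ≤ d
    · simp only [hτ, true_imp_iff]
      rw [ae_all_iff]
      intro l
      by_cases hl : l ∈ net.extLinks
      · simp [hl]
      · have := hEv τ hτ l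
        rw [if_neg hl, measureReal_eq_zero_iff] at this
        filter_upwards [measure_eq_zero_iff_ae_notMem.1 this] with ω hω h
        exact absurd h hω
    · simp [hτ]
  -- Delivered packets are admitted, and both events have the same probability, the total flow out
  -- of the source; so admitted packets are delivered almost surely.
  have hadm : ∀ᵐ ω ∂μ, (∃ l, ω ∈ E 0 l) → ω ∈ D := by
    have hsub : D ⊆ ⋃ l, E 0 l := by
      intro ω hω
      obtain ⟨l, hl⟩ := Option.ne_none_iff_exists'.1 (freeLink_ne_none_of_freeNode
        (sel := fun q τ v => sel q τ v ω) (Nat.succ_pos d) (by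
          have : net.freeNode _ q (d + 1) = _ := hω
          rw [this]; simp))
      exact Set.mem_iUnion.2 ⟨l, hl⟩
    have hle : μ.real (⋃ l, E 0 l) ≤ μ.real D := by
      refine (measureReal_iUnion_fintype_le _).trans_eq ?_
      rw [hDv, ← hf.sum_extLinks q.type (Nat.zero_le _), Finset.sum_congr rfl fun l _ =>
        hEv 0 (Nat.zero_le _) l, Finset.sum_ite_mem, Finset.univ_inter]
    have hdiff : μ ((⋃ l, E 0 l) \ D) = 0 := by
      rw [← measureReal_eq_zero_iff, measureReal_sdiff hsub hD]
      have := measureReal_mono (μ := μ) hsub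
      linarith
    filter_upwards [measure_eq_zero_iff_ae_notMem.1 hdiff] with ω hω h
    by_contra hD'
    exact hω ⟨Set.mem_iUnion.2 h, hD'⟩
  have hI : ∀ τ l, Integrable ((E τ l).indicator (1 : Ω → ℝ)) μ := fun τ l =>
    (integrable_const 1).indicator (hE τ l)
  -- Pointwise, the number of network links used is at most `L` on the event of delivery and zero
  -- elsewhere. Taking expectations bounds the flow without decomposing it into routes.
  have hmono : ∫ ω, ∑ τ ∈ Finset.range (d + 1), ∑ l ∈ net.links,
      (E τ l).indicator (1 : Ω → ℝ) ω ∂μ ≤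
      ∫ ω, net.maxRouteLength * D.indicator (1 : Ω → ℝ) ω ∂μ := by
    refine integral_mono_ae (integrable_finsetSum _ fun τ _ => integrable_finsetSum _ fun l _ =>
      hI τ l) (((integrable_const 1).indicator hD).const_mul _) ?_
    filter_upwards [hext, hadm] with ω h1 h2
    by_cases hω : ω ∈ D
    · rw [Set.indicator_of_mem hω, Pi.one_apply, mul_one]
      refine (Finset.sum_congr rfl fun τ _ => Finset.sum_congr rfl fun l _ => ?_).trans_le
        (sum_freeLink_le_maxRouteLength h1 hω)
      simp [E, Set.indicator]
    · rw [Set.indicator_of_notMem hω, mul_zero]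
      refine (Finset.sum_eq_zero fun τ _ => Finset.sum_eq_zero fun l _ => ?_).le
      refine Set.indicator_of_notMem (fun hl => hω (h2 ?_)) _
      have hl' : net.freeLink (fun q τ v => sel q τ v ω) q τ = some l := hl
      refine Option.ne_none_iff_exists'.1 ?_
      rcases Nat.eq_zero_or_pos τ with rfl | hτ
      · simp [hl']
      · exact freeLink_ne_none_of_freeNode hτ (by rw [(freeLink_eq_some.1 hl').1]; simp)
  rw [integral_finsetSum _ fun τ _ => integrable_finsetSum _ fun l _ => hI τ l,
    integral_const_mul, integral_indicator_one hD, hDv] at hmono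
  refine le_trans (Finset.sum_le_sum fun τ hτ => ?_) hmono
  rw [integral_finsetSum _ fun l _ => hI τ l]
  refine (Finset.sum_congr rfl fun l hl => ?_).le
  have hl' : l ∈ net.extLinks := Finset.mem_union_left _ hl
  rw [integral_indicator_one (hE τ l), hEv τ (Nat.lt_succ_iff.1 (Finset.mem_range.1 hτ)),
    if_pos hl']

theorem sum_packets {M : Type*} [AddCommMonoid M] (T : ℕ) (a : J → ℕ → ℕ) (G : Packet J → M) :
    ∑ q ∈ packets T a, G q =
      ∑ g ∈ Finset.univ ×ˢ Finset.Icc 1 T, ∑ n ∈ Finset.range (a g.1 g.2), G ⟨g, n⟩ := by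
  rw [packets, Finset.sum_sigma]

theorem mem_packets {T : ℕ} {a : J → ℕ → ℕ} {q : Packet J} :
    q ∈ packets T a ↔ q.arrival ∈ Finset.Icc 1 T ∧ q.index < a q.type q.arrival := by
  simp [packets]

/-! ### Measurability of the forwarding -/

section Measurability

variable {Ω : Type*} {mΩ : MeasurableSpace Ω} {T : ℕ} {a : J → ℕ → Ω → ℕ}
  {sel : Packet J → ℕ → V → Ω → Option V} {prio : ℕ → Packet J → Ω → ℕ}

/-- The index set of the sum is random, but only through the countably many values of the batch
sizes. -/
theorem measurable_sum_packets {M : Type*} [AddCommMonoid M] [MeasurableSpace M]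
    [MeasurableAdd₂ M] (ha : ∀ j t, Measurable (a j t)) {G : Packet J → Ω → M}
    (hG : ∀ q, Measurable (G q)) :
    Measurable fun ω => ∑ q ∈ packets T (fun j t => a j t ω), G q ω := by
  simp only [sum_packets]
  refine Finset.measurable_fun_sum _ fun g _ => ?_
  exact (measurable_from_prod_countable_right
    (f := fun x : ℕ × Ω => ∑ n ∈ Finset.range x.1, G ⟨g, n⟩ x.2)
    fun k => by exact Finset.measurable_fun_sum (Finset.range k) fun n _ => hG ⟨g, n⟩).comp
      ((ha g.1 g.2).prodMk measurable_id)

theorem measurableSet_endNode (ha : ∀ j t, Measurable (a j t))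
    (hsel : ∀ q τ v u, MeasurableSet {ω | sel q τ v ω = some u})
    (hprio : ∀ s q, Measurable (prio s q)) (s : ℕ) (q : Packet J) (v : V) :
    MeasurableSet {ω | net.endNode T (fun j t => a j t ω) (fun q τ v => sel q τ v ω)
      (fun s q => prio s q ω) s q = some v} := by
  classical
  induction s generalizing q v with
  | zero => simp [endNode]
  | succ s ih =>
    set prev : Ω → Packet J → Option V := fun ω => net.endNode T (fun j t => a j t ω)
      (fun q τ v => sel q τ v ω) (fun s q => prio s q ω) s with hprev
    have hnode : ∀ q v, MeasurableSet
        {ω | net.nodeIn T (fun j t => a j t ω) (prev ω) (s + 1) q = some v} := by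
      intro q v
      have hpk : MeasurableSet {ω | q ∈ packets T (fun j t => a j t ω)} := by
        simp only [mem_packets]
        exact (MeasurableSet.const _).inter (ha _ _ measurableSet_Ioi)
      have : {ω | net.nodeIn T (fun j t => a j t ω) (prev ω) (s + 1) q = some v} =
          {ω | q ∈ packets T (fun j t => a j t ω)} ∩
          {ω | (if s + 1 = q.arrival then some (net.src q.type)
            else if q.arrival < s + 1 ∧ s + 1 ≤ q.arrival + net.deadline q.type then prev ω q
            else none) = some v} := by
        ext ω
        by_cases h : q ∈ packets T (fun j t => a j t ω) <;> simp [nodeIn, h]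
      rw [this]
      refine hpk.inter ?_
      split_ifs
      · exact MeasurableSet.const _
      · exact ih q v
      · exact MeasurableSet.const _
    have hreq : ∀ q l, MeasurableSet {ω | net.request T (fun j t => a j t ω)
        (fun q τ v => sel q τ v ω) (prev ω) (s + 1) q = some l} := by
      rintro q ⟨v, u⟩
      have : {ω | net.request T (fun j t => a j t ω)
          (fun q τ v => sel q τ v ω) (prev ω) (s + 1) q = some (v, u)} =
          {ω | net.nodeIn T (fun j t => a j t ω) (prev ω) (s + 1) q = some v} ∩
          {ω | sel q (s + 1 - q.arrival) v ω = some u} := by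
        ext ω
        simp only [request, Option.bind_eq_some_iff, Option.map_eq_some_iff, Prod.mk.injEq,
          Set.mem_ofPred_eq, Set.mem_inter_iff]
        constructor
        · rintro ⟨v', hv, u', hu, rfl, rfl⟩
          exact ⟨hv, hu⟩
        · rintro ⟨hv, hu⟩
          exact ⟨v, hv, u, hu, rfl, rfl⟩
      rw [this]
      exact (hnode q v).inter (hsel _ _ _ _)
    have hcard : ∀ q l, MeasurableSet {ω | ((packets T fun j t => a j t ω).filter fun r =>
        net.request T (fun j t => a j t ω) (fun q τ v => sel q τ v ω) (prev ω) (s + 1) r = some l ∧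
          prio (s + 1) r ω < prio (s + 1) q ω).card < net.cap l} := by
      intro q l
      refine measurableSet_lt ?_ measurable_const
      simp only [Finset.card_filter]
      exact measurable_sum_packets ha fun r => Measurable.ite ((hreq r l).inter
        (measurableSet_lt (hprio _ _) (hprio _ _))) measurable_const measurable_const
    have : {ω | net.endNode T (fun j t => a j t ω) (fun q τ v => sel q τ v ω)
        (fun s q => prio s q ω) (s + 1) q = some v} =
        ⋃ l ∈ {l : V × V | l.2 = v}, {ω | net.request T (fun j t => a j t ω)
          (fun q τ v => sel q τ v ω) (prev ω) (s + 1) q = some l} ∩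
          {ω | l ∈ net.links → ((packets T fun j t => a j t ω).filter fun r =>
            net.request T (fun j t => a j t ω) (fun q τ v => sel q τ v ω) (prev ω) (s + 1) r
              = some l ∧ prio (s + 1) r ω < prio (s + 1) q ω).card < net.cap l} := by
      ext ω
      simp only [endNode, slotStep, Option.bind_eq_some_iff, Set.mem_ofPred_eq, Set.mem_iUnion,
        Set.mem_inter_iff, exists_prop, Option.ite_none_right_eq_some, Option.some.injEq]
      constructor
      · rintro ⟨l, hl, hc, hv⟩
        exact ⟨l, hv, hl, hc⟩
      · rintro ⟨l, hv, hl, hc⟩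
        exact ⟨l, hl, hc, hv⟩
    rw [this]
    refine MeasurableSet.biUnion (Set.to_countable _) fun l _ => (hreq q l).inter ?_
    by_cases hl : l ∈ net.links
    · simp only [hl, true_imp_iff]
      exact hcard q l
    · simp [hl]

end Measurability

/-! ### The expected reward -/

section Reward

variable {Ω : Type*} {mΩ : MeasurableSpace Ω} {μ : Measure Ω} {T : ℕ}
  {N : J → ℕ} {p : J → unitInterval} {f : J → V × V → ℕ → ℝ}
  {a : J → ℕ → Ω → ℕ} {sel : Packet J → ℕ → V → Ω → Option V}
  {prio : ℕ → Packet J → Ω → ℕ} {ε : ℝ} [IsProbabilityMeasure μ]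

theorem IsForwardingModel.integral_arrivals
    (hM : net.IsForwardingModel μ T N p f a sel prio) {g : J × ℕ} (hg : g.2 ∈ Finset.Icc 1 T) :
    Integrable (fun ω => (a g.1 g.2 ω : ℝ)) μ ∧ ∫ ω, (a g.1 g.2 ω : ℝ) ∂μ = N g.1 * p g.1 := by
  -- With the sure event in place of `D`, the count is the batch size itself.
  have := hM.integral_sum_indicator hg (D := fun _ => Set.univ) (fun n =>
    @MeasurableSet.univ _ (⨆ i ∈ packetInputs ⟨g, n⟩, inputAlgebra a sel i)) (π := 1)
    (fun _ _ => by simp)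
  simpa using this

theorem IsForwardingModel.integrable_totalWeight
    (hM : net.IsForwardingModel μ T N p f a sel prio) :
    Integrable (fun ω => ∑ g ∈ Finset.univ ×ˢ Finset.Icc 1 T,
      net.weight g.1 * (a g.1 g.2 ω : ℝ)) μ :=
  integrable_finsetSum _ fun _ hg =>
    (hM.integral_arrivals (Finset.mem_product.1 hg).2).1.const_mul _

theorem IsForwardingModel.integrable_reward
    (hM : net.IsForwardingModel μ T N p f a sel prio) (H : ℕ) :
    Integrable (fun ω => net.reward T (fun j t => a j t ω)
      (fun q τ v => sel q τ v ω) (fun s q => prio s q ω) H) μ := by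
  classical
  refine hM.integrable_totalWeight.mono' (Measurable.aestronglyMeasurable ?_)
    (ae_of_all _ fun ω => ?_)
  · unfold reward
    exact measurable_sum_packets hM.measurable_arrivals fun q => Measurable.ite
      (measurableSet_endNode hM.measurable_arrivals (fun _ _ _ _ => hM.measurableSet_sel _ _ _ _)
        hM.measurable_prio _ _ _) measurable_const measurable_const
  · unfold reward
    rw [Real.norm_of_nonneg (Finset.sum_nonneg fun q _ => by
      split_ifs
      exacts [net.weight_nonneg _, le_rfl]), sum_packets]
    refine Finset.sum_le_sum fun g _ => ?_
    refine (Finset.sum_le_sum (g := fun _ => net.weight g.1) fun n _ => ?_).trans_eq ?_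
    · split_ifs
      exacts [le_rfl, net.weight_nonneg _]
    · simp [mul_comm]

/-- Overloads destroy at most a fraction `ε` of the flow of a packet type. -/
theorem IsForwardingModel.sum_flow_mul_exp_le
    (hM : net.IsForwardingModel μ T N p f a sel prio) {rate : J → ℝ}
    (hf : net.FlowFeasible rate ε f) (hε : 0 < ε)
    (hC : ∀ l ∈ net.links,
      2 * ((1 + ε) / ε) ^ 2 * Real.log ((net.maxRouteLength : ℝ) / ε) ≤ (net.cap l : ℝ))
    {q : Packet J} (hq : q.arrival ∈ Finset.Icc 1 T) (hn : q.index < N q.type) :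
    ∑ τ ∈ Finset.range (net.deadline q.type + 1), ∑ l ∈ net.links, f q.type l τ *
      Real.exp (-(net.cap l * (ε / (1 + ε)) ^ 2 / 2)) ≤
      ε * ∑ l ∈ net.outLinks (net.src q.type), f q.type l 0 := by
  have hlen := hM.sum_flow_le_maxRouteLength_mul hf hq hn
  have hf0 : ∀ τ ∈ Finset.range (net.deadline q.type + 1), ∀ l ∈ net.links,
      0 ≤ f q.type l τ := fun τ hτ l hl =>
    hf.nonneg _ l (Finset.mem_union_left _ hl) τ
      ((Nat.lt_succ_iff.1 (Finset.mem_range.1 hτ)).trans (deadline_le_dmax _))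
  have hF0 : 0 ≤ ∑ l ∈ net.outLinks (net.src q.type), f q.type l 0 :=
    Finset.sum_nonneg fun l hl => hf.nonneg _ l (mem_outLinks.1 hl).1 0 (Nat.zero_le _)
  obtain ⟨δ, hδ, hδL⟩ : ∃ δ : ℝ, (∀ l ∈ net.links,
      Real.exp (-(net.cap l * (ε / (1 + ε)) ^ 2 / 2)) ≤ δ) ∧ 0 ≤ δ ∧ δ * net.maxRouteLength ≤ ε := by
    -- `δ` is the overload probability `ε / L`. For `L = 0` the trivial bound `1` is enough, since
    -- there is then no flow on network links to lose.
    rcases Nat.eq_zero_or_pos net.maxRouteLength with hL | hL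
    · refine ⟨1, fun l _ => Real.exp_le_one_iff.2 ?_, zero_le_one, by simp [hL, hε.le]⟩
      have : 0 ≤ net.cap l * (ε / (1 + ε)) ^ 2 / 2 := by positivity
      linarith
    · have hL' : (0 : ℝ) < net.maxRouteLength := by exact_mod_cast hL
      refine ⟨ε / net.maxRouteLength, fun l hl => ?_, by positivity, by field_simp; rfl⟩
      rw [← Real.exp_log (show 0 < ε / net.maxRouteLength by positivity), Real.exp_le_exp,
        ← inv_div (net.maxRouteLength : ℝ), Real.log_inv, neg_le_neg_iff]
      have h := mul_le_mul_of_nonneg_right (hC l hl) (show 0 ≤ (ε / (1 + ε)) ^ 2 / 2 by positivity)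
      have e : 2 * ((1 + ε) / ε) ^ 2 * Real.log ((net.maxRouteLength : ℝ) / ε) *
          ((ε / (1 + ε)) ^ 2 / 2) = Real.log ((net.maxRouteLength : ℝ) / ε) := by
        have : 1 + ε ≠ 0 := by positivity
        field_simp
      rw [e] at h
      linarith
  calc ∑ τ ∈ Finset.range (net.deadline q.type + 1), ∑ l ∈ net.links, f q.type l τ *
        Real.exp (-(net.cap l * (ε / (1 + ε)) ^ 2 / 2))
      ≤ ∑ τ ∈ Finset.range (net.deadline q.type + 1), ∑ l ∈ net.links, f q.type l τ * δ :=
        Finset.sum_le_sum fun τ hτ => Finset.sum_le_sum fun l hl =>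
          mul_le_mul_of_nonneg_left (hδ l hl) (hf0 τ hτ l hl)
    _ = δ * ∑ τ ∈ Finset.range (net.deadline q.type + 1), ∑ l ∈ net.links, f q.type l τ := by
        rw [Finset.mul_sum]
        refine Finset.sum_congr rfl fun τ _ => ?_
        rw [← Finset.sum_mul, mul_comm]
    _ ≤ δ * (net.maxRouteLength * ∑ l ∈ net.outLinks (net.src q.type), f q.type l 0) :=
        mul_le_mul_of_nonneg_left hlen hδL.1
    _ = (δ * net.maxRouteLength) * ∑ l ∈ net.outLinks (net.src q.type), f q.type l 0 := by ring
    _ ≤ _ := mul_le_mul_of_nonneg_right hδL.2 hF0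

open Classical in
/-- The expected number of packets of a batch that are delivered on time. -/
theorem IsForwardingModel.exists_delivered_bound
    (hM : net.IsForwardingModel μ T N p f a sel prio)
    (hf : net.FlowFeasible (fun j => (N j : ℝ) * (p j : ℝ)) ε f) (hε : 0 < ε)
    (hC : ∀ l ∈ net.links,
      2 * ((1 + ε) / ε) ^ 2 * Real.log ((net.maxRouteLength : ℝ) / ε) ≤ (net.cap l : ℝ))
    {H : ℕ} {g : J × ℕ} (hg : g.2 ∈ Finset.Icc 1 T) (hgH : g.2 + net.deadline g.1 ≤ H) :
    ∃ Z : Ω → ℝ, Integrable Z μ ∧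
      (∀ ω, Z ω ≤ ∑ n ∈ Finset.range (a g.1 g.2 ω),
        if net.endNode T (fun j t => a j t ω) (fun q τ v => sel q τ v ω) (fun s q => prio s q ω)
          (min (g.2 + net.deadline g.1) H) ⟨g, n⟩ = some (net.dst g.1) then (1 : ℝ) else 0) ∧
      (N g.1 : ℝ) * p g.1 * ((1 - ε) * ∑ l ∈ net.outLinks (net.src g.1), f g.1 l 0) ≤ ∫ ω, Z ω ∂μ := by
  let D : ℕ → Set Ω := fun n => {ω | net.freeNode (fun q τ v => sel q τ v ω) (⟨g, n⟩ : Packet J)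
    (net.deadline g.1 + 1) = some (net.dst g.1)}
  have hDmeas : ∀ n, MeasurableSet[⨆ i ∈ packetInputs ⟨g, n⟩, inputAlgebra a sel i] (D n) :=
    fun n => measurableSet_freeNode (m := ⨆ i ∈ packetInputs ⟨g, n⟩, inputAlgebra a sel i)
      (fun _ _ _ _ => measurableSet_sel_of_mem (show _ ∈ packetInputs _ from ⟨_, rfl⟩) _) _
  obtain ⟨hDI, hDv⟩ := hM.integral_sum_indicator hg hDmeas
    (π := ∑ l ∈ net.outLinks (net.src g.1), f g.1 l 0) fun n hn =>
    hM.measureReal_freeNode_deadline hf (q := ⟨g, n⟩) hg hn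
  have hQ : ∀ τ, ∀ l : net.links, _ := fun τ l =>
    hM.exists_overload_bound hf hε l.2 (g.2 + τ) hg
  choose Q hQI hQle hQv using hQ
  -- Free deliveries minus the Chernoff majorants of the overloads, summed over ages and links.
  -- Working with the integrable majorants avoids any measurability question for the overload
  -- events.
  refine ⟨fun ω => (∑ n ∈ Finset.range (a g.1 g.2 ω), (D n).indicator (1 : Ω → ℝ) ω) -
    ∑ τ ∈ Finset.range (net.deadline g.1 + 1), ∑ l : net.links, Q τ l ω, ?_, fun ω => ?_, ?_⟩
  · exact hDI.sub (integrable_finsetSum _ fun τ _ => integrable_finsetSum _ fun l _ => hQI τ l)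
  · rw [sub_le_iff_le_add]
    refine le_trans ?_ (add_le_add_right (Finset.sum_le_sum fun τ _ =>
      Finset.sum_le_sum fun l _ => hQle τ l ω) _)
    rw [Finset.sum_congr rfl (s₁ := Finset.range (net.deadline g.1 + 1)) fun τ _ => Finset.sum_comm,
      Finset.sum_comm, ← Finset.sum_add_distrib]
    refine Finset.sum_le_sum fun n hn => ?_
    have hterm : ∀ τ (l : net.links), (0 : ℝ) ≤
        if net.Loads (fun q τ v => sel q τ v ω) (g.2 + τ) (l : V × V) ⟨g, n⟩ ∧
          net.Overloaded T (fun j t => a j t ω) (fun q τ v => sel q τ v ω) (g.2 + τ) l ⟨g, n⟩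
        then (1 : ℝ) else 0 := fun τ l => by split_ifs <;> simp
    have hsum := Finset.sum_nonneg (s := Finset.range (net.deadline g.1 + 1)) fun τ _ =>
      Finset.sum_nonneg (s := Finset.univ) fun l _ => hterm τ l
    by_cases hω : ω ∈ D n
    · rw [Set.indicator_of_mem hω, Pi.one_apply]
      -- A packet delivered in the free motion either meets an overload, and then some subtracted
      -- term is `1`, or is delivered by the actual forwarding as well.
      by_cases hover : ∃ τ ≤ net.deadline g.1, ∃ l ∈ net.links,
          net.freeLink (fun q τ v => sel q τ v ω) (⟨g, n⟩ : Packet J) τ = some l ∧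
          net.Overloaded T (fun j t => a j t ω) (fun q τ v => sel q τ v ω) (g.2 + τ) l ⟨g, n⟩
      · obtain ⟨τ, hτ, l, hl, hfl, hov⟩ := hover
        have hload : net.Loads (fun q τ v => sel q τ v ω) (g.2 + τ) l (⟨g, n⟩ : Packet J) := by
          refine ⟨Nat.le_add_right _ _, Nat.add_le_add_left hτ _, ?_⟩
          rw [show g.2 + τ - Packet.arrival ⟨g, n⟩ = τ from Nat.add_sub_cancel_left _ _]
          exact hfl
        have h1 := Finset.single_le_sum (s := Finset.univ) (fun l _ => hterm τ l)
          (Finset.mem_univ (⟨l, hl⟩ : net.links))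
        rw [if_pos ⟨hload, hov⟩] at h1
        have h2 := Finset.single_le_sum (s := Finset.range (net.deadline g.1 + 1))
          (fun τ _ => Finset.sum_nonneg (s := Finset.univ) fun l _ => hterm τ l)
          (Finset.mem_range.2 (Nat.lt_succ_of_le hτ))
        refine (h1.trans h2).trans (le_add_of_nonneg_left ?_)
        split_ifs <;> simp
      · push Not at hover
        rw [if_pos]
        · linarith
        · rw [min_eq_left hgH]
          have hpk : (⟨g, n⟩ : Packet J) ∈ packets T (fun j t => a j t ω) :=
            mem_packets.2 ⟨hg, Finset.mem_range.1 hn⟩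
          have := endNode_eq_freeNode (prio := fun s q => prio s q ω) hpk
            (fun τ hτ l hl hfl => hover τ hτ l hl hfl) le_rfl
          exact this.trans hω
    · rw [Set.indicator_of_notMem hω]
      refine add_nonneg ?_ hsum
      split_ifs <;> simp
  · rw [integral_sub hDI (integrable_finsetSum _ fun τ _ => integrable_finsetSum _ fun l _ =>
      hQI τ l), hDv, integral_finsetSum _ fun τ _ => integrable_finsetSum _ fun l _ => hQI τ l]
    have hload : ∀ τ ∈ Finset.range (net.deadline g.1 + 1), ∀ l : V × V,
        net.loadProb f (g.2 + τ) l g = f g.1 l τ := by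
      intro τ hτ l
      have := Finset.mem_range.1 hτ
      rw [loadProb, if_pos (by omega), Nat.add_sub_cancel_left]
    have hdrop : ∑ τ ∈ Finset.range (net.deadline g.1 + 1), ∫ ω, ∑ l : net.links, Q τ l ω ∂μ ≤
        N g.1 * p g.1 * ∑ τ ∈ Finset.range (net.deadline g.1 + 1), ∑ l ∈ net.links, f g.1 l τ *
          Real.exp (-(net.cap l * (ε / (1 + ε)) ^ 2 / 2)) := by
      rw [Finset.mul_sum]
      refine Finset.sum_le_sum fun τ hτ => ?_
      rw [integral_finsetSum _ fun l _ => hQI τ l, Finset.mul_sum, ← Finset.sum_coe_sort net.links]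
      refine Finset.sum_le_sum fun l _ => (hQv τ l).trans_eq ?_
      rw [hload τ hτ, mul_assoc]
    have hloss : (N g.1 * p g.1 : ℝ) * ∑ τ ∈ Finset.range (net.deadline g.1 + 1),
        ∑ l ∈ net.links, f g.1 l τ * Real.exp (-(net.cap l * (ε / (1 + ε)) ^ 2 / 2)) ≤
        N g.1 * p g.1 * (ε * ∑ l ∈ net.outLinks (net.src g.1), f g.1 l 0) := by
      -- The flow bound was obtained by following an actual packet, here the one of index `0`; for
      -- `N = 0` there is none, but both sides vanish.
      rcases Nat.eq_zero_or_pos (N g.1) with hN | hN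
      · simp [hN]
      · exact mul_le_mul_of_nonneg_left (hM.sum_flow_mul_exp_le hf hε hC (q := ⟨g, 0⟩) hg hN)
          (mul_nonneg (Nat.cast_nonneg _) (p g.1).2.1)
    linarith

/-- Packets arriving by slot `T - dmax` reach their deadline by `T ≤ H`, so for them the end of the
run is irrelevant; the later ones contribute a nonnegative reward and are discarded. -/
theorem IsForwardingModel.le_integral_reward
    (hM : net.IsForwardingModel μ T N p f a sel prio)
    (hf : net.FlowFeasible (fun j => (N j : ℝ) * (p j : ℝ)) ε f) (hε : 0 < ε)
    (hC : ∀ l ∈ net.links,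
      2 * ((1 + ε) / ε) ^ 2 * Real.log ((net.maxRouteLength : ℝ) / ε) ≤ (net.cap l : ℝ))
    {H : ℕ} (hH : T ≤ H) :
    ((T - net.dmax : ℕ) : ℝ) * ((1 - ε) * net.flowObjective (fun j => (N j : ℝ) * (p j : ℝ)) f) ≤
      ∫ ω, net.reward T (fun j t => a j t ω)
        (fun q τ v => sel q τ v ω) (fun s q => prio s q ω) H ∂μ := by
  classical
  have hdel : ∀ g : (Finset.univ : Finset J) ×ˢ Finset.Icc 1 (T - net.dmax), _ := fun g =>
    hM.exists_delivered_bound (H := H) (g := (g : J × ℕ)) hf hε hC (by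
      have := (Finset.mem_product.1 g.2).2
      simp only [Finset.mem_Icc] at this ⊢
      omega) (by
      have := (Finset.mem_product.1 g.2).2
      have hd := deadline_le_dmax (net := net) (g : J × ℕ).1
      simp only [Finset.mem_Icc] at this
      omega)
  choose Z hZI hZle hZv using hdel
  calc ((T - net.dmax : ℕ) : ℝ) * ((1 - ε) * net.flowObjective (fun j => (N j : ℝ) * (p j : ℝ)) f)
      = ∑ g ∈ Finset.univ ×ˢ Finset.Icc 1 (T - net.dmax), net.weight g.1 * (N g.1 * p g.1 *
          ((1 - ε) * ∑ l ∈ net.outLinks (net.src g.1), f g.1 l 0)) := by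
        rw [Finset.sum_product]
        simp only [Finset.sum_const, Nat.card_Icc, Nat.add_sub_cancel, nsmul_eq_mul]
        rw [flowObjective, Finset.mul_sum, Finset.mul_sum]
        exact Finset.sum_congr rfl fun j _ => by ring
    _ ≤ ∑ g ∈ (Finset.univ ×ˢ Finset.Icc 1 (T - net.dmax)).attach,
          net.weight (g : J × ℕ).1 * ∫ ω, Z g ω ∂μ := by
        rw [← Finset.sum_attach]
        exact Finset.sum_le_sum fun g _ =>
          mul_le_mul_of_nonneg_left (hZv g) (net.weight_nonneg _)
    _ = ∫ ω, ∑ g ∈ (Finset.univ ×ˢ Finset.Icc 1 (T - net.dmax)).attach,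
          net.weight (g : J × ℕ).1 * Z g ω ∂μ := by
        rw [integral_finsetSum _ fun g _ => (hZI g).const_mul _]
        exact Finset.sum_congr rfl fun g _ => (integral_const_mul _ _).symm
    _ ≤ _ := by
        refine integral_mono (integrable_finsetSum _ fun g _ => (hZI g).const_mul _)
          (hM.integrable_reward H) fun ω => ?_
        let R : J × ℕ → ℝ := fun g => ∑ n ∈ Finset.range (a g.1 g.2 ω),
          if net.endNode T (fun j t => a j t ω) (fun q τ v => sel q τ v ω) (fun s q => prio s q ω)
            (min (g.2 + net.deadline g.1) H) ⟨g, n⟩ = some (net.dst g.1) then (1 : ℝ) else 0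
        have hR0 : ∀ g, 0 ≤ net.weight g.1 * R g := fun g =>
          mul_nonneg (net.weight_nonneg _) (Finset.sum_nonneg fun n _ => by split_ifs <;> simp)
        calc ∑ g ∈ (Finset.univ ×ˢ Finset.Icc 1 (T - net.dmax)).attach,
              net.weight (g : J × ℕ).1 * Z g ω
            ≤ ∑ g ∈ (Finset.univ ×ˢ Finset.Icc 1 (T - net.dmax)).attach,
              net.weight (g : J × ℕ).1 * R g := Finset.sum_le_sum fun g _ =>
                mul_le_mul_of_nonneg_left (hZle g ω) (net.weight_nonneg _)
          _ = ∑ g ∈ Finset.univ ×ˢ Finset.Icc 1 (T - net.dmax), net.weight g.1 * R g :=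
              Finset.sum_attach _ fun g : J × ℕ => net.weight g.1 * R g
          _ ≤ ∑ g ∈ Finset.univ ×ˢ Finset.Icc 1 T, net.weight g.1 * R g :=
              Finset.sum_le_sum_of_subset_of_nonneg (Finset.product_subset_product le_rfl
                (Finset.Icc_subset_Icc_right (Nat.sub_le _ _))) fun g _ _ => hR0 g
          _ = _ := by
              simp only [reward, sum_packets]
              refine Finset.sum_congr rfl fun g _ => ?_
              simp only [R, Finset.mul_sum, mul_ite, mul_one, mul_zero]

end Reward

/-! ### Existence of optimal flows -/

theorem FlowFeasible.mem_Icc {rate : J → ℝ} {ε : ℝ} {f : J → V × V → ℕ → ℝ}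
    (hf : net.FlowFeasible rate ε f) {j : J} {l : V × V} (hl : l ∈ net.extLinks) {τ : ℕ}
    (hτ : τ ≤ net.deadline j) : f j l τ ∈ Set.Icc (0 : ℝ) 1 := by
  have h0 : ∀ l ∈ net.extLinks, 0 ≤ f j l τ := fun l hl =>
    hf.nonneg j l hl τ (hτ.trans (deadline_le_dmax j))
  refine ⟨h0 l hl, ?_⟩
  calc f j l τ ≤ ∑ l ∈ net.extLinks, f j l τ := Finset.single_le_sum h0 hl
    _ = _ := hf.sum_extLinks j hτ
    _ ≤ 1 := hf.one_choice j

theorem isClosed_flowFeasible (rate : J → ℝ) (ε : ℝ) :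
    IsClosed {f | net.FlowFeasible rate ε f} := by
  have : {f | net.FlowFeasible rate ε f} =
      (⋂ j, ⋂ l ∈ net.extLinks, ⋂ τ ≤ net.dmax, {f | 0 ≤ f j l τ}) ∩
      (⋂ j, {f | ∑ l ∈ net.outLinks (net.src j), f j l 0 ≤ 1}) ∩
      (⋂ j, ⋂ v, ⋂ τ ∈ Finset.Icc 1 (net.deadline j),
        {f | ∑ l ∈ net.inLinks v, f j l (τ - 1) = ∑ l ∈ net.outLinks v, f j l τ}) ∩
      (⋂ j, ⋂ l ∈ net.extLinks, ⋂ _ : l ∉ net.outLinks (net.src j), {f | f j l 0 = 0}) ∩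
      (⋂ j, ⋂ l ∈ net.extLinks, ⋂ _ : l ∉ net.inLinks (net.dst j),
        {f | f j l (net.deadline j) = 0}) ∩
      ⋂ l ∈ net.links, {f | ∑ j, ∑ τ ∈ Finset.range (net.deadline j + 1), rate j * f j l τ ≤
        net.cap l / (1 + ε)} := by
    ext f
    simp only [Set.mem_inter_iff, Set.mem_iInter, Set.mem_ofPred_eq]
    exact ⟨fun h => ⟨⟨⟨⟨⟨h.nonneg, h.one_choice⟩, h.conservation⟩, h.source⟩, h.destination⟩,
      h.capacity⟩, fun ⟨⟨⟨⟨⟨h1, h2⟩, h3⟩, h4⟩, h5⟩, h6⟩ => ⟨h1, h2, h3, h4, h5, h6⟩⟩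
  rw [this]
  refine ((((IsClosed.inter ?_ ?_).inter ?_).inter ?_).inter ?_).inter ?_
  · exact isClosed_iInter fun j => isClosed_iInter fun l => isClosed_iInter fun _ =>
      isClosed_iInter fun τ => isClosed_iInter fun _ => isClosed_le (by fun_prop) (by fun_prop)
  · exact isClosed_iInter fun j => isClosed_le (by fun_prop) (by fun_prop)
  · exact isClosed_iInter fun j => isClosed_iInter fun l => isClosed_iInter fun _ =>
      isClosed_iInter fun _ => isClosed_eq (by fun_prop) (by fun_prop)
  · exact isClosed_iInter fun j => isClosed_iInter fun l => isClosed_iInter fun _ =>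
      isClosed_iInter fun _ => isClosed_eq (by fun_prop) (by fun_prop)
  · exact isClosed_iInter fun j => isClosed_iInter fun l => isClosed_iInter fun _ =>
      isClosed_iInter fun _ => isClosed_eq (by fun_prop) (by fun_prop)
  · exact isClosed_iInter fun j => isClosed_iInter fun _ => isClosed_le (by fun_prop) (by fun_prop)

/-- The values of a flow outside the network or after the deadline are irrelevant. -/
theorem FlowFeasible.truncate {rate : J → ℝ} {ε : ℝ} {g : J → V × V → ℕ → ℝ}
    (hg : net.FlowFeasible rate ε g) :
    net.FlowFeasible rate ε
      (fun j l τ => if l ∈ net.extLinks ∧ τ ≤ net.deadline j then g j l τ else 0) := by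
  have hin : ∀ j v τ, τ ≤ net.deadline j → ∑ l ∈ net.inLinks v,
      (if l ∈ net.extLinks ∧ τ ≤ net.deadline j then g j l τ else 0) =
      ∑ l ∈ net.inLinks v, g j l τ := fun j v τ hτ =>
    Finset.sum_congr rfl fun l hl => if_pos ⟨(mem_inLinks.1 hl).1, hτ⟩
  have hout : ∀ j v τ, τ ≤ net.deadline j → ∑ l ∈ net.outLinks v,
      (if l ∈ net.extLinks ∧ τ ≤ net.deadline j then g j l τ else 0) =
      ∑ l ∈ net.outLinks v, g j l τ := fun j v τ hτ =>
    Finset.sum_congr rfl fun l hl => if_pos ⟨(mem_outLinks.1 hl).1, hτ⟩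
  refine ⟨fun j l hl τ hτ => ?_, fun j => ?_, fun j v τ hτ => ?_, fun j l hl h => ?_,
    fun j l hl h => ?_, fun l hl => ?_⟩
  · split_ifs
    exacts [hg.nonneg j l hl τ hτ, le_rfl]
  · rw [hout j _ 0 (Nat.zero_le _)]
    exact hg.one_choice j
  · have := Finset.mem_Icc.1 hτ
    rw [hin j v _ (by omega), hout j v _ (by omega)]
    exact hg.conservation j v τ hτ
  · simp [hg.source j l hl h]
  · simp [hg.destination j l hl h]
  · refine (Finset.sum_le_sum fun j _ => (Finset.sum_congr rfl fun τ hτ => ?_).le).trans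
      (hg.capacity l hl)
    have hl' : l ∈ net.extLinks := Finset.mem_union_left _ hl
    rw [if_pos ⟨hl', Nat.lt_succ_iff.1 (Finset.mem_range.1 hτ)⟩]

/-- The objective is continuous on a compact set. Ages range over all of `ℕ` and some coordinates
are unconstrained, so the feasible set is intersected with a unit box, compact by Tychonoff;
truncation moves any feasible flow into the box without changing its objective. -/
theorem exists_isOptimalFlow (rate : J → ℝ) {ε : ℝ} (hε : 0 < ε) :
    ∃ f, net.IsOptimalFlow rate ε f := by
  let B : Set (J → V × V → ℕ → ℝ) :=
    Set.univ.pi fun _ => Set.univ.pi fun _ => Set.univ.pi fun _ => Set.Icc 0 1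
  have hB : IsCompact B := isCompact_univ_pi fun _ => isCompact_univ_pi fun _ =>
    isCompact_univ_pi fun _ => isCompact_Icc
  have hK : IsCompact (B ∩ {f | net.FlowFeasible rate ε f}) :=
    hB.inter_right (isClosed_flowFeasible rate ε)
  have hzero : net.FlowFeasible rate ε 0 := by
    refine ⟨?_, ?_, ?_, ?_, ?_, ?_⟩ <;> intros <;> simp
    positivity
  have hcont : Continuous (net.flowObjective rate) := by
    unfold flowObjective
    fun_prop
  obtain ⟨f, ⟨_, hf⟩, hmax⟩ := hK.exists_isMaxOn
    ⟨0, fun _ _ _ _ _ _ => ⟨le_rfl, zero_le_one⟩, hzero⟩ hcont.continuousOn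
  refine ⟨f, hf, fun g hg => ?_⟩
  have hmem : (fun j l τ => if l ∈ net.extLinks ∧ τ ≤ net.deadline j then g j l τ else 0) ∈
      B ∩ {f | net.FlowFeasible rate ε f} := by
    refine ⟨fun j _ l _ τ _ => ?_, hg.truncate⟩
    dsimp only
    split_ifs with h
    · exact hg.mem_Icc h.1 h.2
    · simp
  refine le_of_eq_of_le ?_ (hmax hmem)
  refine Finset.sum_congr rfl fun j _ => ?_
  congr 1
  exact Finset.sum_congr rfl fun l hl => (if_pos ⟨(mem_outLinks.1 hl).1, Nat.zero_le _⟩).symm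

/-! ### Flows of weighted routes -/

open Classical in
variable (net) in
/-- The flow over links obtained by superposing routes with weights `c`. -/
noncomputable def routeFlow (c : (j : J) → (Fin (net.deadline j + 1) → V × V) → ℝ)
    (j : J) (l : V × V) (τ : ℕ) : ℝ :=
  ∑ k ∈ (net.routes j).filter (fun k => UsesAt k τ l), c j k

theorem mem_routes {j : J} {k : Fin (net.deadline j + 1) → V × V} :
    k ∈ net.routes j ↔ net.IsRouteSchedule j k := by
  simp [routes]

section RouteFlow

variable {c : (j : J) → (Fin (net.deadline j + 1) → V × V) → ℝ}

-- At each age up to the deadline a route uses exactly one link, so it is counted at most once.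
open Classical in
theorem sum_routeFlow (S : Finset (V × V)) (j : J) (τ : Fin (net.deadline j + 1)) :
    ∑ l ∈ S, net.routeFlow c j l τ = ∑ k ∈ net.routes j, if k τ ∈ S then c j k else 0 := by
  simp only [routeFlow, Finset.sum_filter]
  rw [Finset.sum_comm]
  refine Finset.sum_congr rfl fun k _ => ?_
  simp [UsesAt, τ.2]

theorem sum_routeFlow_src (j : J) :
    ∑ l ∈ net.outLinks (net.src j), net.routeFlow c j l 0 = ∑ k ∈ net.routes j, c j k := by
  classical
  have := sum_routeFlow (c := c) (net.outLinks (net.src j)) j 0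
  rw [Fin.val_zero] at this
  rw [this]
  exact Finset.sum_congr rfl fun k hk => if_pos (mem_routes.1 hk).2.2.1

theorem routeFlow_nonneg (hc : ∀ j k, 0 ≤ c j k) (j : J) (l : V × V) (τ : ℕ) :
    0 ≤ net.routeFlow c j l τ :=
  Finset.sum_nonneg fun k _ => hc j k

/-- Each route is a walk from the source to the destination, so the link constraints other than
capacity hold route by route. -/
theorem flowFeasible_routeFlow {rate : J → ℝ} {ε : ℝ} (hc : ∀ j k, 0 ≤ c j k)
    (hone : ∀ j, ∑ k ∈ net.routes j, c j k ≤ 1)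
    (hcap : ∀ l ∈ net.links, ∑ j, ∑ τ ∈ Finset.range (net.deadline j + 1),
      rate j * net.routeFlow c j l τ ≤ net.cap l / (1 + ε)) :
    net.FlowFeasible rate ε (net.routeFlow c) := by
  classical
  refine ⟨fun j l _ τ _ => routeFlow_nonneg hc j l τ, fun j => ?_, fun j v τ hτ => ?_,
    fun j l hl h => ?_, fun j l hl h => ?_, hcap⟩
  · rw [sum_routeFlow_src]
    exact hone j
  · obtain ⟨h1, h2⟩ := Finset.mem_Icc.1 hτ
    obtain ⟨i, rfl⟩ : ∃ i, τ = i + 1 := ⟨τ - 1, by omega⟩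
    let i' : Fin (net.deadline j) := ⟨i, h2⟩
    have e1 := sum_routeFlow (c := c) (net.inLinks v) j i'.castSucc
    have e2 := sum_routeFlow (c := c) (net.outLinks v) j i'.succ
    simp only [Fin.val_castSucc, Fin.val_succ, i'] at e1 e2
    rw [Nat.add_sub_cancel, e1, e2]
    refine Finset.sum_congr rfl fun k hk => ?_
    have hr := mem_routes.1 hk
    have hiff : k i'.castSucc ∈ net.inLinks v ↔ k i'.succ ∈ net.outLinks v := by
      rw [mem_inLinks, mem_outLinks, hr.2.1 i']
      simp only [hr.1, true_and]
    exact if_congr hiff rfl rfl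
  · refine Finset.sum_eq_zero fun k hk => ?_
    obtain ⟨hk', h0, rfl⟩ := Finset.mem_filter.1 hk
    exact absurd (mem_routes.1 hk').2.2.1 h
  · refine Finset.sum_eq_zero fun k hk => ?_
    obtain ⟨hk', h0, rfl⟩ := Finset.mem_filter.1 hk
    exact absurd (mem_routes.1 hk').2.2.2 h

end RouteFlow

/-! ### The random integer program -/

/-- The number of packets of type `j` that are scheduled over the route `k`. -/
def routeCount (T : ℕ) (a : J → ℕ → ℕ) (y : net.Schedule) (j : J)
    (k : Fin (net.deadline j + 1) → V × V) : ℕ :=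
  ∑ t ∈ Finset.Icc 1 T, ∑ n ∈ Finset.range (a j t), y j t n k

theorem riObjective_eq_sum_routeCount (T : ℕ) (a : J → ℕ → ℕ) (y : net.Schedule) :
    net.riObjective T a y =
      ∑ j, net.weight j * ∑ k ∈ net.routes j, (routeCount T a y j k : ℝ) := by
  rw [riObjective, Finset.sum_comm]
  refine Finset.sum_congr rfl fun j _ => ?_
  rw [← Finset.mul_sum]
  congr 1
  simp only [routeCount, Nat.cast_sum]
  rw [Finset.sum_comm (s := net.routes j)]
  exact Finset.sum_congr rfl fun t _ => Finset.sum_comm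

theorem RIFeasible.sum_routeCount_le {T : ℕ} {a : J → ℕ → ℕ} {y : net.Schedule}
    (hy : net.RIFeasible T a y) (j : J) :
    ∑ k ∈ net.routes j, routeCount T a y j k ≤ ∑ t ∈ Finset.Icc 1 T, a j t := by
  simp only [routeCount]
  rw [Finset.sum_comm]
  refine Finset.sum_le_sum fun t ht => ?_
  rw [Finset.sum_comm]
  calc _ ≤ ∑ n ∈ Finset.range (a j t), 1 :=
        Finset.sum_le_sum fun n hn => hy.one_choice t ht j n (Finset.mem_range.1 hn)
    _ = a j t := by simp

open Classical in
/-- The total load of a link over all slots. -/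
theorem RIFeasible.sum_usage_le {T : ℕ} {a : J → ℕ → ℕ} {y : net.Schedule}
    (hy : net.RIFeasible T a y) {l : V × V} (hl : l ∈ net.links) :
    ∑ j, ∑ τ ∈ Finset.range (net.deadline j + 1),
      ∑ k ∈ (net.routes j).filter (fun k => UsesAt k τ l), routeCount T a y j k ≤
      (T + net.dmax) * net.cap l := by
  let B : J → ℕ → ℕ → ℕ := fun j t τ => ∑ n ∈ Finset.range (a j t),
    ∑ k ∈ (net.routes j).filter (fun k => UsesAt k τ l), y j t n k
  calc ∑ j, ∑ τ ∈ Finset.range (net.deadline j + 1),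
        ∑ k ∈ (net.routes j).filter (fun k => UsesAt k τ l), routeCount T a y j k
      = ∑ j, ∑ τ ∈ Finset.range (net.deadline j + 1), ∑ t ∈ Finset.Icc 1 T, B j t τ := by
        refine Finset.sum_congr rfl fun j _ => Finset.sum_congr rfl fun τ _ => ?_
        simp only [routeCount, B]
        rw [Finset.sum_comm]
        exact Finset.sum_congr rfl fun t _ => Finset.sum_comm
    -- Ages run up to `dmax` for every type, so that the age range no longer depends on the type and
    -- the slots can be regrouped.
    _ ≤ ∑ j, ∑ τ ∈ Finset.range (net.dmax + 1), ∑ t ∈ Finset.Icc 1 T, B j t τ :=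
        Finset.sum_le_sum fun j _ => Finset.sum_le_sum_of_subset
          (Finset.range_subset_range.2 (Nat.succ_le_succ (deadline_le_dmax j)))
    _ = ∑ x ∈ Finset.range (net.dmax + 1) ×ˢ Finset.Icc 1 T, ∑ j, B j x.2 x.1 := by
        rw [Finset.sum_comm, Finset.sum_product]
        exact Finset.sum_congr rfl fun τ _ => Finset.sum_comm
    -- Substitute `s = t + τ`, the slot in which the link is used; the window for `t` is then the
    -- one in the capacity constraint.
    _ = ∑ x ∈ (Finset.Icc 1 (T + net.dmax)).sigma
          fun s => Finset.Icc (max 1 (s - net.dmax)) (min s T), ∑ j, B j x.2 (x.1 - x.2) := by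
        refine Finset.sum_nbij' (fun x => ⟨x.1 + x.2, x.2⟩) (fun x => (x.1 - x.2, x.2))
          ?_ ?_ ?_ ?_ ?_
        · rintro ⟨τ, t⟩ h
          simp only [Finset.mem_product, Finset.mem_range, Finset.mem_Icc, Finset.mem_sigma] at h ⊢
          omega
        · rintro ⟨s, t⟩ h
          simp only [Finset.mem_product, Finset.mem_range, Finset.mem_Icc, Finset.mem_sigma] at h ⊢
          omega
        · rintro ⟨τ, t⟩ _
          simp
        · rintro ⟨s, t⟩ h
          simp only [Finset.mem_Icc, Finset.mem_sigma] at h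
          have : s - t + t = s := by omega
          simp [this]
        · rintro ⟨τ, t⟩ _
          simp
    _ = ∑ s ∈ Finset.Icc 1 (T + net.dmax),
          ∑ t ∈ Finset.Icc (max 1 (s - net.dmax)) (min s T), ∑ j, B j t (s - t) :=
        Finset.sum_sigma _ _ _
    _ ≤ ∑ s ∈ Finset.Icc 1 (T + net.dmax), net.cap l :=
        Finset.sum_le_sum fun s hs => hy.capacity l hl s hs
    _ = _ := by simp

theorem RIFeasible.congr {T : ℕ} {a b : J → ℕ → ℕ}
    (hab : ∀ j, ∀ t ∈ Finset.Icc 1 T, a j t = b j t) {y : net.Schedule}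
    (hy : net.RIFeasible T a y) : net.RIFeasible T b y := by
  refine ⟨hy.binary, fun t ht j n hn => hy.one_choice t ht j n (by rwa [hab j t ht]),
    fun l hl s hs => ?_⟩
  refine le_of_eq_of_le ?_ (hy.capacity l hl s hs)
  refine Finset.sum_congr rfl fun t ht => Finset.sum_congr rfl fun j _ => ?_
  rw [hab j t (by simp only [Finset.mem_Icc] at ht ⊢; omega)]

theorem riOptimum_congr {T : ℕ} {a b : J → ℕ → ℕ}
    (hab : ∀ j, ∀ t ∈ Finset.Icc 1 T, a j t = b j t) :
    net.riOptimum T a = net.riOptimum T b := by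
  have hobj : net.riObjective T a = net.riObjective T b := by
    funext y
    exact Finset.sum_congr rfl fun t ht => Finset.sum_congr rfl fun j _ => by rw [hab j t ht]
  have hfeas : {y | net.RIFeasible T a y} = {y | net.RIFeasible T b y} :=
    Set.ext fun y => ⟨fun h => h.congr hab, fun h => h.congr fun j t ht => (hab j t ht).symm⟩
  rw [riOptimum, riOptimum, hobj, hfeas]

/-- Arrival numbers given on a finite horizon, extended by `0`. -/
def extendArrivals (T : ℕ) (α : J × Finset.Icc 1 T → ℕ) (j : J) (t : ℕ) : ℕ :=
  if h : t ∈ Finset.Icc 1 T then α (j, ⟨t, h⟩) else 0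

/-! ### Averaging the integer optimum into a flow -/

section Expectation

variable {Ω : Type*} {mΩ : MeasurableSpace Ω} {μ : Measure Ω} {T : ℕ}
  {N : J → ℕ} {p : J → unitInterval} {f : J → V × V → ℕ → ℝ}
  {a : J → ℕ → Ω → ℕ} {sel : Packet J → ℕ → V → Ω → Option V}
  {prio : ℕ → Packet J → Ω → ℕ} {ε : ℝ}

/-- Every function of the arrival numbers is integrable. -/
theorem IsForwardingModel.integrable_comp_arrivals [IsProbabilityMeasure μ]
    (hM : net.IsForwardingModel μ T N p f a sel prio) (φ : (J × Finset.Icc 1 T → ℕ) → ℝ) :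
    Integrable (fun ω => φ fun g => a g.1 g.2 ω) μ := by
  classical
  have hmeas : Measurable fun ω => fun g : J × Finset.Icc 1 T => a g.1 g.2 ω :=
    measurable_pi_lambda _ fun g => hM.measurable_arrivals _ _
  -- Almost surely the arrival vector lies in this finite set, so any function of it is essentially
  -- bounded.
  let S : Finset (J × Finset.Icc 1 T → ℕ) := Fintype.piFinset fun g => Finset.range (N g.1 + 1)
  refine Integrable.of_bound ((measurable_of_countable φ).comp hmeas).aestronglyMeasurable
    (∑ α ∈ S, |φ α|) ?_
  have hle : ∀ᵐ ω ∂μ, ∀ g : J × Finset.Icc 1 T, a g.1 g.2 ω ≤ N g.1 :=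
    ae_all_iff.2 fun g => ae_le_of_hasLaw_binomial (hM.arrivals_law g.1 g.2 g.2.2)
  filter_upwards [hle] with ω hω
  refine Finset.single_le_sum (f := fun α => |φ α|) (fun α _ => abs_nonneg _) ?_
  exact Fintype.mem_piFinset.2 fun g => Finset.mem_range.2 (Nat.lt_succ_of_le (hω g))

theorem IsForwardingModel.integrable_riOptimum [IsProbabilityMeasure μ]
    (hM : net.IsForwardingModel μ T N p f a sel prio) :
    Integrable (fun ω => net.riOptimum T (fun j t => a j t ω)) μ := by
  refine (hM.integrable_comp_arrivals fun α => net.riOptimum T (extendArrivals T α)).congr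
    (ae_of_all _ fun ω => riOptimum_congr fun j t ht => ?_)
  rw [extendArrivals, dif_pos ht]

/-- The expected optimum of the integer program is bounded by the flow linear program. -/
theorem IsForwardingModel.integral_riOptimum_le [IsProbabilityMeasure μ]
    (hM : net.IsForwardingModel μ T N p f a sel prio) (hε : 0 < ε) (hT : 0 < T)
    (hf : net.IsOptimalFlow (fun j => (N j : ℝ) * (p j : ℝ)) ε f) :
    ∫ ω, net.riOptimum T (fun j t => a j t ω) ∂μ ≤
      (T + net.dmax) * (1 + ε) * net.flowObjective (fun j => (N j : ℝ) * (p j : ℝ)) f := by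
  classical
  set rate : J → ℝ := fun j => (N j : ℝ) * (p j : ℝ) with hrate_def
  have hrate : ∀ j, 0 ≤ rate j := fun j => mul_nonneg (Nat.cast_nonneg _) (p j).2.1
  set M : ℝ := (T + net.dmax) * (1 + ε) with hMdef
  have hTpos : (0 : ℝ) < T := by exact_mod_cast hT
  have hM0 : 0 < M := by positivity
  -- The optimal schedule is chosen for each arrival vector rather than for each outcome, so all
  -- quantities derived from it are functions of the arrivals and hence integrable.
  have hopt : ∀ α, ∃ y : net.Schedule, net.RIFeasible T (extendArrivals T α) y ∧
      net.riObjective T (extendArrivals T α) y = net.riOptimum T (extendArrivals T α) := fun α =>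
    (net.isGreatest_riOptimum T (extendArrivals T α)).1
  choose y hyF hyO using hopt
  let c : (J × Finset.Icc 1 T → ℕ) → (j : J) → (Fin (net.deadline j + 1) → V × V) → ℝ :=
    fun α j k => routeCount T (extendArrivals T α) (y α) j k
  let r : Ω → J × Finset.Icc 1 T → ℕ := fun ω g => a g.1 g.2 ω
  have hcI : ∀ j k, Integrable (fun ω => c (r ω) j k) μ := fun j k =>
    hM.integrable_comp_arrivals fun α => c α j k
  let e : (j : J) → (Fin (net.deadline j + 1) → V × V) → ℝ := fun j k => ∫ ω, c (r ω) j k ∂μ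
  have he0 : ∀ j k, 0 ≤ e j k := fun j k => integral_nonneg fun ω => Nat.cast_nonneg _
  have hesum : ∀ j (S : Finset (Fin (net.deadline j + 1) → V × V)),
      ∑ k ∈ S, e j k = ∫ ω, ∑ k ∈ S, c (r ω) j k ∂μ := fun j S =>
    (integral_finsetSum _ fun k _ => hcI j k).symm
  have hetotal : ∀ j, ∑ k ∈ net.routes j, e j k ≤ T * rate j := by
    intro j
    have hint : ∀ t ∈ Finset.Icc 1 T, Integrable (fun ω => (a j t ω : ℝ)) μ := fun t ht =>
      (hM.integral_arrivals (g := (j, t)) ht).1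
    calc ∑ k ∈ net.routes j, e j k = ∫ ω, ∑ k ∈ net.routes j, c (r ω) j k ∂μ := hesum j _
      _ ≤ ∫ ω, ∑ t ∈ Finset.Icc 1 T, (a j t ω : ℝ) ∂μ := by
        refine integral_mono (integrable_finsetSum _ fun k _ => hcI j k)
          (integrable_finsetSum _ hint) fun ω => ?_
        have h := (hyF (r ω)).sum_routeCount_le j
        have h2 : ∑ t ∈ Finset.Icc 1 T, extendArrivals T (r ω) j t =
            ∑ t ∈ Finset.Icc 1 T, a j t ω :=
          Finset.sum_congr rfl fun t ht => by rw [extendArrivals, dif_pos ht]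
        rw [h2] at h
        simp only [c]
        exact_mod_cast h
      _ = T * rate j := by
        rw [integral_finsetSum _ hint, Finset.sum_congr rfl fun t ht =>
          (hM.integral_arrivals (g := (j, t)) ht).2]
        simp [rate]
  have hecap : ∀ l ∈ net.links, ∑ j, ∑ τ ∈ Finset.range (net.deadline j + 1),
      net.routeFlow e j l τ ≤ (T + net.dmax) * net.cap l := by
    intro l hl
    have hI : ∀ j τ, Integrable (fun ω =>
        ∑ k ∈ (net.routes j).filter (fun k => UsesAt k τ l), c (r ω) j k) μ := fun j τ =>
      integrable_finsetSum _ fun k _ => hcI j k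
    simp only [routeFlow, hesum]
    rw [Finset.sum_congr rfl fun j _ => (integral_finsetSum _ fun τ _ => hI j τ).symm,
      ← integral_finsetSum _ fun j _ => integrable_finsetSum _ fun τ _ => hI j τ]
    calc _ ≤ ∫ _ω, ((T + net.dmax) * net.cap l : ℝ) ∂μ := by
          refine integral_mono (integrable_finsetSum _ fun j _ => integrable_finsetSum _ fun τ _ =>
            hI j τ) (integrable_const _) fun ω => ?_
          have h := (hyF (r ω)).sum_usage_le hl
          simp only [c]
          exact_mod_cast h
      _ = _ := by simp
  have hevalue : ∫ ω, net.riOptimum T (fun j t => a j t ω) ∂μ =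
      ∑ j, net.weight j * ∑ k ∈ net.routes j, e j k := by
    simp only [hesum]
    simp only [← integral_const_mul]
    rw [← integral_finsetSum _ fun j _ =>
      (integrable_finsetSum _ fun k _ => hcI j k).const_mul _]
    refine integral_congr_ae (ae_of_all _ fun ω => ?_)
    have h : net.riOptimum T (fun j t => a j t ω) = net.riOptimum T (extendArrivals T (r ω)) :=
      riOptimum_congr fun j t ht => by rw [extendArrivals, dif_pos ht]
    exact h.trans ((hyO (r ω)).symm.trans (riObjective_eq_sum_routeCount _ _ _))
  -- A type with zero rate is almost surely absent, so the division by `rate j` in the normalised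
  -- weights loses nothing.
  have hezero : ∀ j, rate j = 0 → ∀ k ∈ net.routes j, e j k = 0 := by
    intro j hj
    have h := hetotal j
    rw [hj, mul_zero] at h
    exact (Finset.sum_eq_zero_iff_of_nonneg fun k _ => he0 j k).1
      (h.antisymm (Finset.sum_nonneg fun k _ => he0 j k))
  have hscale : ∀ j, ∀ k ∈ net.routes j, rate j * (e j k / (rate j * M)) = e j k / M := by
    intro j k hk
    by_cases hj : rate j = 0
    · rw [hezero j hj k hk, hj]; simp
    · field_simp
  -- The expected number of packets per route, relative to `rate j` expected arrivals per slot. `M`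
  -- includes `T + dmax` because usage spreads over that many slots, and `1 + ε` to meet the reduced
  -- capacities.
  let c' : (j : J) → (Fin (net.deadline j + 1) → V × V) → ℝ := fun j k => e j k / (rate j * M)
  have hfeas : net.FlowFeasible rate ε (net.routeFlow c') := by
    refine flowFeasible_routeFlow (fun j k => div_nonneg (he0 j k)
      (mul_nonneg (hrate j) hM0.le)) (fun j => ?_) fun l hl => ?_
    · rw [← Finset.sum_div]
      refine div_le_one_of_le₀ ((hetotal j).trans ?_) (mul_nonneg (hrate j) hM0.le)
      rw [mul_comm]
      refine mul_le_mul_of_nonneg_left ?_ (hrate j)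
      have : (0 : ℝ) ≤ net.dmax := Nat.cast_nonneg _
      rw [hMdef]
      nlinarith
    · have h1 : ∑ j, ∑ τ ∈ Finset.range (net.deadline j + 1), rate j * net.routeFlow c' j l τ =
          (∑ j, ∑ τ ∈ Finset.range (net.deadline j + 1), net.routeFlow e j l τ) / M := by
        simp only [Finset.sum_div, routeFlow, Finset.mul_sum]
        exact Finset.sum_congr rfl fun j _ => Finset.sum_congr rfl fun τ _ =>
          Finset.sum_congr rfl fun k hk => hscale j k (Finset.mem_filter.1 hk).1
      rw [h1, div_le_iff₀ hM0]
      refine (hecap l hl).trans_eq ?_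
      rw [hMdef]
      field_simp
  have hobj : net.flowObjective rate (net.routeFlow c') =
      (∫ ω, net.riOptimum T (fun j t => a j t ω) ∂μ) / M := by
    rw [hevalue, flowObjective, Finset.sum_div]
    refine Finset.sum_congr rfl fun j _ => ?_
    rw [sum_routeFlow_src, mul_assoc, mul_div_assoc, Finset.mul_sum, Finset.sum_div]
    exact congrArg _ (Finset.sum_congr rfl fun k hk => hscale j k hk)
  have := hf.2 _ hfeas
  rw [hobj, div_le_iff₀ hM0] at this
  linarith

end Expectation

theorem FlowFeasible.flowObjective_nonneg {rate : J → ℝ} (hrate : ∀ j, 0 ≤ rate j) {ε : ℝ}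
    {f : J → V × V → ℕ → ℝ} (hf : net.FlowFeasible rate ε f) : 0 ≤ net.flowObjective rate f :=
  Finset.sum_nonneg fun j _ => mul_nonneg (mul_nonneg (net.weight_nonneg j) (hrate j))
    (Finset.sum_nonneg fun l hl => hf.nonneg j l (mem_outLinks.1 hl).1 0 (Nat.zero_le _))

end PacketNetwork

/-! ### Combining the two bounds -/

theorem theorem1 {V J : Type*} [Fintype V] [DecidableEq V] [Fintype J]
    (net : PacketNetwork V J) (N : J → ℕ) (p : J → unitInterval)
    (ε : ℝ) (hε : ε ∈ Set.Ioo (0 : ℝ) (1 / 3)) (T : ℕ)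
    (hC : ∀ l ∈ net.links,
      2 * ((1 + ε) / ε) ^ 2 * Real.log ((net.maxRouteLength : ℝ) / ε) ≤ (net.cap l : ℝ))
    (hT : 2 * (net.dmax : ℝ) ^ 2 / ε ≤ (T : ℝ)) :
    (∃ f, net.IsOptimalFlow (fun j => (N j : ℝ) * (p j : ℝ)) ε f) ∧
    ∀ f, net.IsOptimalFlow (fun j => (N j : ℝ) * (p j : ℝ)) ε f →
      ∀ {Ω : Type*} [MeasurableSpace Ω] (μ : Measure Ω) [IsProbabilityMeasure μ]
        (a : J → ℕ → Ω → ℕ) (sel : Packet J → ℕ → V → Ω → Option V)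
        (prio : ℕ → Packet J → Ω → ℕ),
        net.IsForwardingModel μ T N p f a sel prio →
        ∀ H : ℕ, T ≤ H →
          Integrable (fun ω => net.riOptimum T (fun j t => a j t ω)) μ ∧
          Integrable (fun ω => net.reward T (fun j t => a j t ω)
            (fun q τ v => sel q τ v ω) (fun s q => prio s q ω) H) μ ∧
          (1 - 3 * ε) * ∫ ω, net.riOptimum T (fun j t => a j t ω) ∂μ ≤
            ∫ ω, net.reward T (fun j t => a j t ω)
              (fun q τ v => sel q τ v ω) (fun s q => prio s q ω) H ∂μ := by
  obtain ⟨hε0, hε1⟩ := hε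
  refine ⟨PacketNetwork.exists_isOptimalFlow _ hε0, ?_⟩
  intro f hf Ω _ μ _ a sel prio hM H hH
  refine ⟨hM.integrable_riOptimum, hM.integrable_reward H, ?_⟩
  have hO : 0 ≤ net.flowObjective (fun j => (N j : ℝ) * (p j : ℝ)) f :=
    hf.1.flowObjective_nonneg fun j => mul_nonneg (Nat.cast_nonneg _) (p j).2.1
  have hlow := hM.le_integral_reward hf.1 hε0 hC hH
  rw [div_le_iff₀ hε0] at hT
  -- `dmax` is a natural number, so `2 * dmax ≤ 2 * dmax ^ 2 ≤ ε * T`, and the boundary slots cost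
  -- at most an `ε`-fraction of the horizon.
  have hsq : (net.dmax : ℝ) ≤ (net.dmax : ℝ) ^ 2 := by exact_mod_cast Nat.le_self_pow two_ne_zero _
  have hd0 : (0 : ℝ) ≤ net.dmax := Nat.cast_nonneg _
  have hT0 : (0 : ℝ) ≤ T := Nat.cast_nonneg _
  have hdT : net.dmax ≤ T := by
    have : (net.dmax : ℝ) ≤ T := by nlinarith
    exact_mod_cast this
  -- For `T = 0` nothing arrives, and the normalisation by `T + dmax` is not available.
  rcases Nat.eq_zero_or_pos T with rfl | hTpos
  · have h0 : ∀ ω, net.riOptimum 0 (fun j t => a j t ω) = 0 := fun ω => by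
      obtain ⟨y, _, hy⟩ := (net.isGreatest_riOptimum 0 (fun j t => a j t ω)).1
      rw [← hy]
      simp [PacketNetwork.riObjective]
    simp only [h0, integral_zero, mul_zero]
    simpa using hlow
  · have hup := hM.integral_riOptimum_le hε0 hTpos hf
    rw [Nat.cast_sub hdT] at hlow
    -- The difference of the two sides is `T * (ε + 3 * ε ^ 2) - dmax * (2 - 3 * ε - 3 * ε ^ 2)`,
    -- nonnegative because `2 * dmax ≤ ε * T`.
    have harith : (1 - 3 * ε) * ((T + net.dmax) * (1 + ε)) ≤ (T - net.dmax) * (1 - ε) := by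
      have h1 : 0 ≤ (T : ℝ) * ε ^ 2 := by positivity
      have h2 : 0 ≤ (net.dmax : ℝ) * ε := by positivity
      have h3 : 0 ≤ (net.dmax : ℝ) * ε ^ 2 := by positivity
      nlinarith
    calc _ ≤ (1 - 3 * ε) * ((T + net.dmax) * (1 + ε) *
          net.flowObjective (fun j => (N j : ℝ) * (p j : ℝ)) f) :=
          mul_le_mul_of_nonneg_left hup (by linarith)
      _ = (1 - 3 * ε) * ((T + net.dmax) * (1 + ε)) *
          net.flowObjective (fun j => (N j : ℝ) * (p j : ℝ)) f := by ring
      _ ≤ (T - net.dmax) * (1 - ε) * net.flowObjective (fun j => (N j : ℝ) * (p j : ℝ)) f :=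
          mul_le_mul_of_nonneg_right harith hO
      _ ≤ _ := by linarith
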